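/- **Setting.** Let $M\subseteq\mathbb R^d$ be open and let $V:M\to[1,\infty)$ be a smooth function whose sublevel sets $\{V\le R\}$ are compact. Call a smooth function $f$ on $M$ *tempered* if each derivative of $f$ is bounded by a constant times a power of $V$ (for $M=\mathbb R^d$ and $V=\sqrt{1+|x|^2}$: all derivatives have polynomial growth). A family of such functions is *bounded* if, for each order of derivative, constant and power can be chosen common to the family. Assume that $V$ is tempered. Let $F_i,\sigma_i,\tilde F_i,\tilde\sigma_i$ $(i=1,\dots,d)$ be tempered, put $$\mathcal K=\sum_{i=1}^d F_i\,\partial_{x_i}+\sigma_i^2\,\partial_{x_i}^2 ,$$ and let $u(t)=e^{t\mathcal K}u$, that is $u(t)(x)=\mathbb E[u(x(t))\mid x(0)=x]$, be the Markov semigroup of a diffusion in $M$ with generator $\mathcal K$. Its transition probabilities satisfy the Chapman–Kolmogorov equation and solve the forward equation when tested against $C_c^\infty(M)$. Assume that tempered functions are integrable against the transition probabilities and that the semigroup maps bounded families of tempered functions to bounded families of tempered functions, uniformly on bounded time intervals. Let $\rho>0$ be a smooth steady state density: $\rho\,dx$ is a probability measure on $M$ invariant under the semigroup. Assume that $\rho$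 decays at the boundary of $M$ (and at infinity) in the sense that $\rho$ and its first and second derivatives are integrable against every power of $V$. Write $\langle f\rangle=\int_M f\rho\,dx$. **Perturbation.** Let $G_i$ and $H_i^2$ be integrable on bounded subintervals of $[0,\infty)$. For $0<\delta\le\delta_0$ let $\rho_\delta(t)$, $t\ge 0$, be probability measures on $M$ with $\rho_\delta(0)=\rho\,dx$ that solve, in the sense of distributions on $M$, the Fokker–Planck equation $\partial_t\rho_\delta=\mathcal K_\delta(t)^*\rho_\delta$ of the perturbed system, where $$\mathcal K_\delta(t)=\mathcal K+\sum_{i=1}^d \delta G_i(t)\,\tilde F_i\,\partial_{x_i}+\delta H_i(t)^2\,\tilde\sigma_i^2\,\partial_{x_i}^2 .$$ (This is the generator of $dx_i=F_i\,dt+\sqrt2\,\sigma_i\,dW_i+\delta G_i(t)\tilde F_i\,dt+\sqrt{2\delta}\,H_i(t)\tilde\sigma_i\,d\tilde W_i$ with independent Wiener processes $W,\tilde W$.) Assume that all moments $\int V^k\,d\rho_\delta(t)$ are bounded uniformly in $0<\delta\le\delta_0$ and $t$ in bounded intervals. For an observable $u$ write $\langle u(t)\rangle_{\rho_\delta}=\int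 u\,d\rho_\delta(t)$. **Theorem.** For every tempered observable $u$ all averages and time integrals below exist, and for $t\ge0$ $$\langle u(t)\rangle_{\rho_\delta}-\langle u(t)\rangle=-\sum_{i=1}^d\int_0^t\Big\langle\frac1\rho\,\partial_{x_i}(\tilde F_i\rho)\,u(t-s)\Big\rangle\,\delta G_i(s)\,ds+\sum_{i=1}^d\int_0^t\Big\langle\Big(\partial_{x_i}^2(\tilde\sigma_i^2)+\frac2\rho\,\partial_{x_i}(\tilde\sigma_i^2)\,\partial_{x_i}\rho+\frac1\rho\,\tilde\sigma_i^2\,\partial_{x_i}^2\rho\Big)u(t-s)\Big\rangle\,\delta H_i^2(s)\,ds+O(\delta^2),$$ where the $O(\delta^2)$ is uniform for $0<\delta\le\delta_0$ and for $t$ in bounded intervals. If moreover the perturbation is homogeneous, $G_i=G$ and $H_i=H$ for all $i$, then $$\langle u(t)\rangle_{\rho_\delta}-\langle u(t)\rangle=-\int_0^t\Big\langle\frac1\rho\,\nabla\cdot(\tilde F\rho)\,u(t-s)\Big\rangle\,\delta G(s)\,ds+\int_0^t\Big\langle\Big(\nabla\cdot L_{\tilde\sigma}+\frac2\rho\,L_{\tilde\sigma}\cdot\nabla\rho+\frac1\rho\,D_{\tilde\sigma}\rho\Big)u(t-s)\Big\rangle\,\delta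 H^2(s)\,ds+O(\delta^2)$$ with the same uniformity, where $L_{\tilde\sigma}=[\partial_{x_i}(\tilde\sigma_i^2)]_{i=1}^d$ and $D_{\tilde\sigma}=\sum_{i=1}^d\tilde\sigma_i^2\,\partial_{x_i}^2$. -/

import Mathlib

open MeasureTheory ProbabilityTheory Set
open scoped ContDiff

noncomputable section

/-- The coordinate space in which the state manifold `M` lies. -/
abbrev State (d : ℕ) : Type := EuclideanSpace ℝ (Fin d)

/-- The partial derivative `∂f/∂xᵢ`. -/
def pderiv {d : ℕ} (i : Fin d) (f : State d → ℝ) (x : State d) : ℝ :=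
  fderiv ℝ f x (EuclideanSpace.single i 1)

/-- The Kolmogorov backward operator `∑ᵢ bᵢ ∂ᵢ + aᵢ ∂ᵢ²` with drift components `bᵢ` and
diagonal diffusion coefficients `aᵢ`. -/
def kolmogorovOp {d : ℕ} (b a : Fin d → State d → ℝ) (f : State d → ℝ) (x : State d) : ℝ :=
  ∑ i, (b i x * pderiv i f x + a i x * pderiv i (pderiv i f) x)

/-- The unperturbed generator `K = ∑ᵢ Fᵢ ∂ᵢ + σᵢ² ∂ᵢ²`. -/
def generator {d : ℕ} (F σ : Fin d → State d → ℝ) : (State d → ℝ) → State d → ℝ :=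
  kolmogorovOp F (fun i x => σ i x ^ 2)

/-- The generator at time `t` of the perturbed system,
`∑ᵢ Fᵢ ∂ᵢ + σᵢ² ∂ᵢ² + δ Gᵢ(t) F̃ᵢ ∂ᵢ + δ Hᵢ(t)² σ̃ᵢ² ∂ᵢ²`. -/
def perturbedGenerator {d : ℕ} (F σ F' σ' : Fin d → State d → ℝ) (G H : Fin d → ℝ → ℝ)
    (δ t : ℝ) : (State d → ℝ) → State d → ℝ :=
  kolmogorovOp (fun i x => F i x + δ * G i t * F' i x)
    (fun i x => σ i x ^ 2 + δ * H i t ^ 2 * σ' i x ^ 2)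

/-- `μ t`, `t ≥ 0`, are probability measures on `M` that start from `μ₀` and solve the
Fokker-Planck equation `∂ₜ μ = A(t)* μ` in the sense of distributions, tested against the smooth
functions with compact support in `M`. The laws at time `t` of any solution in `M` of the Itô
equation with generator `A(t)` and initial law `μ₀` are such a family. -/
structure IsFokkerPlanckSolution {d : ℕ} (M : Set (State d))
    (A : ℝ → (State d → ℝ) → State d → ℝ) (μ₀ : Measure (State d))
    (μ : ℝ → Measure (State d)) : Prop where
  initial : μ 0 = μ₀
  isProb : ∀ t, 0 ≤ t → IsProbabilityMeasure (μ t)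
  mem : ∀ t, 0 ≤ t → μ t Mᶜ = 0
  weak : ∀ φ : State d → ℝ, ContDiff ℝ ∞ φ → HasCompactSupport φ → tsupport φ ⊆ M →
    ∀ t, 0 ≤ t →
      IntervalIntegrable (fun s => ∫ x, A s φ x ∂(μ s)) volume 0 t ∧
      ∫ x, φ x ∂(μ t) = ∫ x, φ x ∂μ₀ + ∫ s in (0 : ℝ)..t, ∫ x, A s φ x ∂(μ s)

/-- `κ t x` is the law at time `t` of the diffusion in `M` with generator `A` started at `x`:
it solves the forward equation from the point mass at `x`, and the family satisfies the
Chapman-Kolmogorov equation. -/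
structure IsTransitionFunction {d : ℕ} (M : Set (State d))
    (A : (State d → ℝ) → State d → ℝ) (κ : ℝ → Kernel (State d) (State d)) : Prop where
  forward : ∀ x ∈ M, IsFokkerPlanckSolution M (fun _ => A) (Measure.dirac x) (fun t => κ t x)
  chapman : ∀ s t, 0 ≤ s → 0 ≤ t → ∀ x ∈ M, κ (s + t) x = (κ s x).bind (κ t)

/-- The Markov semigroup `(e^{tK} f)(x) = E[f(x(t)) | x(0) = x]`. -/
def semigroup {d : ℕ} (κ : ℝ → Kernel (State d) (State d)) (t : ℝ) (f : State d → ℝ)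
    (x : State d) : ℝ :=
  ∫ y, f y ∂(κ t x)

/-- A bounded family of tempered observables on `M`, relative to the weight `V`: smooth functions
on `M` each of whose derivatives is bounded by a multiple of a power of `V`, with multiple and
power common to the family. -/
def IsTemperedFamily {d : ℕ} (M : Set (State d)) (V : State d → ℝ) (S : Set (State d → ℝ)) :
    Prop :=
  (∀ f ∈ S, ContDiffOn ℝ ∞ f M) ∧
    ∀ n : ℕ, ∃ (k : ℕ) (C : ℝ), ∀ f ∈ S, ∀ x ∈ M, ‖iteratedFDeriv ℝ n f x‖ ≤ C * V x ^ k

/-- A single tempered observable. -/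
def IsTempered {d : ℕ} (M : Set (State d)) (V : State d → ℝ) (f : State d → ℝ) : Prop :=
  IsTemperedFamily M V {f}

/-- A weight on `M`: a smooth tempered function `V ≥ 1` with compact sublevel sets, so that
`V → ∞` at the boundary of `M` and at infinity. For `M = ℝᵈ` and `V = √(1 + |x|²)`, tempered
means smooth with all derivatives of polynomial growth. -/
structure IsWeight {d : ℕ} (M : Set (State d)) (V : State d → ℝ) : Prop where
  one_le : ∀ x ∈ M, 1 ≤ V x
  isCompact : ∀ R : ℝ, IsCompact {x | x ∈ M ∧ V x ≤ R}
  tempered : IsTempered M V V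

/-- The Markov semigroup acts on tempered observables: their conditional expectations exist, and
on bounded time intervals bounded families stay bounded families of tempered observables. -/
structure ActsOnTempered {d : ℕ} (M : Set (State d)) (V : State d → ℝ)
    (κ : ℝ → Kernel (State d) (State d)) : Prop where
  integrable : ∀ f, IsTempered M V f → ∀ t, 0 ≤ t → ∀ x ∈ M, Integrable f (κ t x)
  bounded : ∀ S, IsTemperedFamily M V S → ∀ T : ℝ,
    IsTemperedFamily M V {g | ∃ f ∈ S, ∃ t ∈ Icc 0 T, g = semigroup κ t f}

/-- The measure `ρ dx` on `M`. -/
def densityMeasure {d : ℕ} (M : Set (State d)) (ρ : State d → ℝ) : Measure (State d) :=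
  (volume.restrict M).withDensity (fun x => ENNReal.ofReal (ρ x))

/-- `ρ` is a smooth positive steady state density on `M`: `ρ dx` is a probability measure that is
invariant under the Markov semigroup. -/
structure IsSteadyState {d : ℕ} (M : Set (State d)) (κ : ℝ → Kernel (State d) (State d))
    (ρ : State d → ℝ) : Prop where
  smooth : ContDiffOn ℝ ∞ ρ M
  pos : ∀ x ∈ M, 0 < ρ x
  isProb : IsProbabilityMeasure (densityMeasure M ρ)
  invariant : ∀ t, 0 ≤ t → Kernel.Invariant (κ t) (densityMeasure M ρ)

/-- Decay of `ρ` towards the boundary of `M`: `ρ` and its first two derivatives are integrable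
against every power of `V`. -/
def DecaysAtBoundary {d : ℕ} (M : Set (State d)) (V ρ : State d → ℝ) : Prop :=
  ∀ k : ℕ, ∀ n ≤ 2, IntegrableOn (fun x => V x ^ k * ‖iteratedFDeriv ℝ n ρ x‖) M

/-- The steady state average `⟨f⟩ = ∫_M f ρ dx`. -/
def steadyAverage {d : ℕ} (M : Set (State d)) (ρ f : State d → ℝ) : ℝ :=
  ∫ x in M, f x * ρ x

/-- `(1/ρ) ∂ᵢ(F̃ᵢ ρ)`. -/
def driftResponse {d : ℕ} (ρ : State d → ℝ) (F' : Fin d → State d → ℝ) (i : Fin d)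
    (x : State d) : ℝ :=
  1 / ρ x * pderiv i (fun y => F' i y * ρ y) x

/-- `∂ᵢ²(σ̃ᵢ²) + (2/ρ) ∂ᵢ(σ̃ᵢ²) ∂ᵢρ + (1/ρ) σ̃ᵢ² ∂ᵢ²ρ`. -/
def noiseResponse {d : ℕ} (ρ : State d → ℝ) (σ' : Fin d → State d → ℝ) (i : Fin d)
    (x : State d) : ℝ :=
  pderiv i (pderiv i (fun y => σ' i y ^ 2)) x
    + 2 / ρ x * pderiv i (fun y => σ' i y ^ 2) x * pderiv i ρ x
    + 1 / ρ x * σ' i x ^ 2 * pderiv i (pderiv i ρ) x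

/-- The divergence of the vector field with components `Xᵢ`. -/
def divergence {d : ℕ} (X : Fin d → State d → ℝ) (x : State d) : ℝ :=
  ∑ i, pderiv i (X i) x

/-- The vector field `L_σ̃ = [∂ᵢ(σ̃ᵢ²)]ᵢ`. -/
def noiseVector {d : ℕ} (σ' : Fin d → State d → ℝ) (i : Fin d) (x : State d) : ℝ :=
  pderiv i (fun y => σ' i y ^ 2) x

/-- The operator `D_σ̃ = ∑ᵢ σ̃ᵢ² ∂ᵢ²`. -/
def noiseOp {d : ℕ} (σ' : Fin d → State d → ℝ) (f : State d → ℝ) (x : State d) : ℝ :=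
  ∑ i, σ' i x ^ 2 * pderiv i (pderiv i f) x

/-- `(1/ρ) ∇·(F̃ ρ)`. -/
def driftResponseVec {d : ℕ} (ρ : State d → ℝ) (F' : Fin d → State d → ℝ) (x : State d) : ℝ :=
  1 / ρ x * divergence (fun i y => F' i y * ρ y) x

/-- `∇·L_σ̃ + (2/ρ) L_σ̃·∇ρ + (1/ρ) D_σ̃ ρ`. -/
def noiseResponseVec {d : ℕ} (ρ : State d → ℝ) (σ' : Fin d → State d → ℝ) (x : State d) : ℝ :=
  divergence (noiseVector σ') x
    + 2 / ρ x * (∑ i, noiseVector σ' i x * pderiv i ρ x)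
    + 1 / ρ x * noiseOp σ' ρ x

end

/-! Write `P_t` for the semigroup, `μ_s` for the perturbed law, and follow `Ψ(s) = ∫ P_{t-s} u dμ_s`
from `s = 0`, where invariance of `ρ dx` gives `⟨P_t u⟩ = ⟨u⟩`, to `s = t`, where it is `∫ u dμ_t`.
The backward motion of `P_{t-s} u` and the forward motion of `μ_s` cancel as far as the unperturbed
generator is concerned, so `Ψ` changes only at the rate `δ ∫ L_s P_{t-s} u dμ_s`, with `L_s = ∑ᵢ
Gᵢ(s) F̃ᵢ ∂ᵢ + Hᵢ(s)² σ̃ᵢ² ∂ᵢ²` (Duhamel).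

This is used twice. A crude bound on the rate gives `∫ u dμ_t - ⟨u⟩ = O(δ)`, uniformly over bounded
families of observables (`exists_abs_integral_sub_steadyAverage_le`). The functions `F̃ᵢ ∂ᵢ P_τ u`
and `σ̃ᵢ² ∂ᵢ² P_τ u`, `τ ≤ T`, form such families, so `μ_s` may be replaced by `ρ dx` inside the
rate at a total cost `O(δ²)`. Integration by parts against `ρ` then moves the derivatives from `P_τ
u` to the coefficients and `ρ`, which produces the response functions.

Since `Gᵢ` and `Hᵢ²` are merely integrable, `Ψ` is not differentiated. Instead
`exists_duhamel_local` gives its increment over `[s, s']` up to an error `O((s' - s) ∫_s^{s'} m)`,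
with `m` the integrable majorant `perturbationSize`, and `abs_sub_le_of_local_increment_le` sums
over refining partitions, in which these errors disappear. Only forward equations enter, for the
transition probabilities and for `μ`.

Those equations are given for test functions of compact support. Cutting off along the level sets of
`V` changes a tempered function by at most `C/(n+1)` times a power of `V`; bounded moments then
extend the equations to tempered functions, and the decay of `ρ` removes the boundary terms in the
integration by parts. -/

open Filter Topology

/-! ### Calculus of bounded families of tempered functions -/

section TemperedFamilies

variable {d : ℕ} {M : Set (State d)} {V : State d → ℝ} {α : Type*} {A : Set α}
  {φ ψ : α → State d → ℝ}

theorem IsTemperedFamily.mono {S S' : Set (State d → ℝ)} (h : IsTemperedFamily M V S')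
    (hS : S ⊆ S') : IsTemperedFamily M V S :=
  ⟨fun f hf => h.1 f (hS hf), fun n => by
    obtain ⟨k, C, hC⟩ := h.2 n
    exact ⟨k, C, fun f hf => hC f (hS hf)⟩⟩

/-- One power and one constant serve for all derivatives up to a given order. -/
theorem IsTemperedFamily.exists_bound_le {S : Set (State d → ℝ)} (h : IsTemperedFamily M V S)
    (hV : ∀ x ∈ M, 1 ≤ V x) (n : ℕ) :
    ∃ (k : ℕ) (C : ℝ), 0 ≤ C ∧
      ∀ i ≤ n, ∀ f ∈ S, ∀ x ∈ M, ‖iteratedFDeriv ℝ i f x‖ ≤ C * V x ^ k := by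
  choose k C hC using h.2
  -- Sums serve as maxima: each nonnegative term lies below the sum, and powers of `V ≥ 1` grow with
  -- the exponent.
  refine ⟨∑ i ∈ Finset.range (n + 1), k i, ∑ i ∈ Finset.range (n + 1), |C i|,
    Finset.sum_nonneg fun i _ => abs_nonneg _, fun i hi f hf x hx => ?_⟩
  have hV1 := hV x hx
  have hmem : i ∈ Finset.range (n + 1) := by simp; omega
  calc ‖iteratedFDeriv ℝ i f x‖ ≤ C i * V x ^ k i := hC i f hf x hx
    _ ≤ |C i| * V x ^ k i := by gcongr; exact le_abs_self _
    _ ≤ _ := by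
      refine mul_le_mul
        (Finset.single_le_sum (f := fun i => |C i|) (fun i _ => abs_nonneg _) hmem)
        (pow_le_pow_right₀ hV1
          (Finset.single_le_sum (f := k) (fun i _ => Nat.zero_le _) hmem)) (by positivity)
        (Finset.sum_nonneg fun i _ => abs_nonneg _)

theorem IsTemperedFamily.exists_abs_le {S : Set (State d → ℝ)} (h : IsTemperedFamily M V S)
    (hV : ∀ x ∈ M, 1 ≤ V x) :
    ∃ (k : ℕ) (C : ℝ), 0 ≤ C ∧ ∀ f ∈ S, ∀ x ∈ M, |f x| ≤ C * V x ^ k := by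
  obtain ⟨k, C, hC, hb⟩ := h.exists_bound_le hV 0
  refine ⟨k, C, hC, fun f hf x hx => ?_⟩
  simpa using hb 0 le_rfl f hf x hx

theorem IsTempered.exists_abs_le {f : State d → ℝ} (h : IsTempered M V f)
    (hV : ∀ x ∈ M, 1 ≤ V x) : ∃ (k : ℕ) (C : ℝ), 0 ≤ C ∧ ∀ x ∈ M, |f x| ≤ C * V x ^ k := by
  obtain ⟨k, C, hC, hb⟩ := IsTemperedFamily.exists_abs_le h hV
  exact ⟨k, C, hC, hb f rfl⟩

theorem IsTemperedFamily.isTempered {S : Set (State d → ℝ)} (h : IsTemperedFamily M V S)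
    {f : State d → ℝ} (hf : f ∈ S) : IsTempered M V f :=
  h.mono (by simpa using hf)

theorem IsTemperedFamily.isTempered_image (h : IsTemperedFamily M V (φ '' A)) {a : α}
    (ha : a ∈ A) : IsTempered M V (φ a) :=
  h.isTempered (mem_image_of_mem _ ha)

theorem IsTempered.contDiffOn {f : State d → ℝ} (h : IsTempered M V f) : ContDiffOn ℝ ∞ f M :=
  h.1 f rfl

theorem IsTempered.const_family {f : State d → ℝ} (h : IsTempered M V f) :
    IsTemperedFamily M V ((fun _ : α => f) '' A) :=
  IsTemperedFamily.mono h (by rintro _ ⟨a, -, rfl⟩; rfl)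

/-- Families are carried as images `φ '' A`, so that sums, products and derivatives are formed index
by index with constants common to all indices. -/
theorem isTemperedFamily_image_iff :
    IsTemperedFamily M V (φ '' A) ↔ (∀ a ∈ A, ContDiffOn ℝ ∞ (φ a) M) ∧
      ∀ n : ℕ, ∃ (k : ℕ) (C : ℝ), ∀ a ∈ A, ∀ x ∈ M, ‖iteratedFDeriv ℝ n (φ a) x‖ ≤ C * V x ^ k := by
  simp only [IsTemperedFamily, forall_mem_image]

theorem iteratedFDeriv_mul_norm_le (hM : IsOpen M) {f g : State d → ℝ}
    (hf : ContDiffOn ℝ ∞ f M) (hg : ContDiffOn ℝ ∞ g M) {x : State d} (hx : x ∈ M) (n : ℕ) :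
    ‖iteratedFDeriv ℝ n (fun y => f y * g y) x‖ ≤
      ∑ i ∈ Finset.range (n + 1), (n.choose i : ℝ) * ‖iteratedFDeriv ℝ i f x‖ *
        ‖iteratedFDeriv ℝ (n - i) g x‖ := by
  have := norm_iteratedFDerivWithin_mul_le hf hg hM.uniqueDiffOn hx (n := n)
    (by exact_mod_cast le_top)
  simpa only [iteratedFDerivWithin_of_isOpen _ hM hx] using this

theorem IsTemperedFamily.mul (hM : IsOpen M) (hV : ∀ x ∈ M, 1 ≤ V x)
    (hφ : IsTemperedFamily M V (φ '' A)) (hψ : IsTemperedFamily M V (ψ '' A)) :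
    IsTemperedFamily M V ((fun a x => φ a x * ψ a x) '' A) := by
  refine isTemperedFamily_image_iff.2 ⟨fun a ha => (hφ.isTempered_image ha).contDiffOn.mul
    (hψ.isTempered_image ha).contDiffOn, fun n => ?_⟩
  obtain ⟨k, C, hC, hb⟩ := hφ.exists_bound_le hV n
  obtain ⟨l, D, hD, hc⟩ := hψ.exists_bound_le hV n
  refine ⟨k + l, ∑ i ∈ Finset.range (n + 1), (n.choose i : ℝ) * C * D, fun a ha x hx => ?_⟩
  refine (iteratedFDeriv_mul_norm_le hM (hφ.isTempered_image ha).contDiffOn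
    (hψ.isTempered_image ha).contDiffOn hx n).trans ?_
  rw [Finset.sum_mul]
  refine Finset.sum_le_sum fun i hi => ?_
  have hi' : i ≤ n := by simp at hi; omega
  have h1 := hb i hi' _ (mem_image_of_mem _ ha) x hx
  have h2 := hc (n - i) (by omega) _ (mem_image_of_mem _ ha) x hx
  have := hV x hx
  calc _ ≤ (n.choose i : ℝ) * (C * V x ^ k) * (D * V x ^ l) := by gcongr
    _ = _ := by ring

theorem IsTemperedFamily.add (hM : IsOpen M) (hV : ∀ x ∈ M, 1 ≤ V x)
    (hφ : IsTemperedFamily M V (φ '' A)) (hψ : IsTemperedFamily M V (ψ '' A)) :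
    IsTemperedFamily M V ((fun a x => φ a x + ψ a x) '' A) := by
  refine isTemperedFamily_image_iff.2 ⟨fun a ha => (hφ.isTempered_image ha).contDiffOn.add
    (hψ.isTempered_image ha).contDiffOn, fun n => ?_⟩
  obtain ⟨k, C, hC, hb⟩ := hφ.exists_bound_le hV n
  obtain ⟨l, D, hD, hc⟩ := hψ.exists_bound_le hV n
  refine ⟨k + l, C + D, fun a ha x hx => ?_⟩
  have h1 := hb n le_rfl _ (mem_image_of_mem _ ha) x hx
  have h2 := hc n le_rfl _ (mem_image_of_mem _ ha) x hx
  have h3 : iteratedFDeriv ℝ n (fun x => φ a x + ψ a x) x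
      = iteratedFDeriv ℝ n (φ a) x + iteratedFDeriv ℝ n (ψ a) x :=
    iteratedFDeriv_add_apply
      (((hφ.isTempered_image ha).contDiffOn.contDiffAt (hM.mem_nhds hx)).of_le
        (by exact_mod_cast le_top))
      (((hψ.isTempered_image ha).contDiffOn.contDiffAt (hM.mem_nhds hx)).of_le
        (by exact_mod_cast le_top))
  have := hV x hx
  rw [h3]
  calc _ ≤ C * V x ^ k + D * V x ^ l := (norm_add_le _ _).trans (add_le_add h1 h2)
    _ ≤ C * V x ^ (k + l) + D * V x ^ (k + l) := by
      gcongr <;> first | assumption | omega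
    _ = _ := by ring

theorem isTempered_const (c : ℝ) : IsTempered M V (fun _ => c) := by
  refine ⟨by rintro f rfl; exact contDiffOn_const, fun n => ⟨0, |c|, ?_⟩⟩
  rintro f rfl x hx
  rcases n with _ | n
  · simp
  · rw [iteratedFDeriv_const_of_ne (by omega)]; simp

theorem IsTemperedFamily.sum (hM : IsOpen M) (hV : ∀ x ∈ M, 1 ≤ V x) {ι : Type*} (s : Finset ι)
    {Φ : ι → α → State d → ℝ} (h : ∀ i ∈ s, IsTemperedFamily M V (Φ i '' A)) :
    IsTemperedFamily M V ((fun a x => ∑ i ∈ s, Φ i a x) '' A) := by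
  classical
  induction s using Finset.induction_on with
  | empty => simpa using (isTempered_const 0).const_family (A := A)
  | insert i s hi ih =>
    simp only [Finset.sum_insert hi]
    exact (h i (by simp)).add hM hV (ih fun j hj => h j (by simp [hj]))

theorem contDiffOn_pderiv (hM : IsOpen M) {f : State d → ℝ} (hf : ContDiffOn ℝ ∞ f M)
    (i : Fin d) : ContDiffOn ℝ ∞ (pderiv i f) M :=
  (hf.fderiv_of_isOpen hM (m := ∞) (by exact_mod_cast le_top)).clm_apply contDiffOn_const

theorem norm_iteratedFDeriv_pderiv_le (hM : IsOpen M) {f : State d → ℝ}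
    (hf : ContDiffOn ℝ ∞ f M) (i : Fin d) (n : ℕ) {x : State d} (hx : x ∈ M) :
    ‖iteratedFDeriv ℝ n (pderiv i f) x‖ ≤ ‖iteratedFDeriv ℝ (n + 1) f x‖ := by
  have h := norm_iteratedFDeriv_clm_apply_const (f := fderiv ℝ f)
    (c := (EuclideanSpace.single i 1 : State d)) (x := x) (N := ∞) (n := n)
    ((hf.fderiv_of_isOpen hM (m := ∞) (by exact_mod_cast le_top)).contDiffAt (hM.mem_nhds hx))
    (by exact_mod_cast le_top)
  rw [norm_iteratedFDeriv_fderiv] at h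
  simp only [PiLp.norm_single, norm_one, one_mul] at h
  exact h

theorem IsTemperedFamily.pderiv (hM : IsOpen M) (hφ : IsTemperedFamily M V (φ '' A))
    (i : Fin d) : IsTemperedFamily M V ((fun a => pderiv i (φ a)) '' A) := by
  refine isTemperedFamily_image_iff.2
    ⟨fun a ha => contDiffOn_pderiv hM (hφ.isTempered_image ha).contDiffOn i, fun n => ?_⟩
  obtain ⟨k, C, hb⟩ := hφ.2 (n + 1)
  exact ⟨k, C, fun a ha x hx =>
    (norm_iteratedFDeriv_pderiv_le hM (hφ.isTempered_image ha).contDiffOn i n hx).trans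
      (hb _ (mem_image_of_mem _ ha) x hx)⟩

theorem IsTemperedFamily.kolmogorovOp (hM : IsOpen M) (hV : ∀ x ∈ M, 1 ≤ V x)
    {b a : Fin d → State d → ℝ} (hb : ∀ i, IsTempered M V (b i)) (ha : ∀ i, IsTempered M V (a i))
    (hφ : IsTemperedFamily M V (φ '' A)) :
    IsTemperedFamily M V ((fun c => kolmogorovOp b a (φ c)) '' A) :=
  IsTemperedFamily.sum hM hV Finset.univ
    (Φ := fun i c x => b i x * _root_.pderiv i (φ c) x
      + a i x * _root_.pderiv i (_root_.pderiv i (φ c)) x) fun i _ =>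
    ((hb i).const_family.mul hM hV (hφ.pderiv hM i)).add hM hV
      ((ha i).const_family.mul hM hV ((hφ.pderiv hM i).pderiv hM i))

theorem IsTempered.mul (hM : IsOpen M) (hV : ∀ x ∈ M, 1 ≤ V x) {f g : State d → ℝ}
    (hf : IsTempered M V f) (hg : IsTempered M V g) : IsTempered M V (fun x => f x * g x) := by
  have := (hf.const_family (A := (univ : Set Unit))).mul hM hV hg.const_family
  exact this.isTempered_image (mem_univ ())

theorem IsTempered.pow (hM : IsOpen M) (hV : ∀ x ∈ M, 1 ≤ V x) {f : State d → ℝ}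
    (hf : IsTempered M V f) (k : ℕ) : IsTempered M V (fun x => f x ^ k) := by
  induction k with
  | zero => simpa using isTempered_const 1
  | succ k ih => simpa only [pow_succ] using ih.mul hM hV hf

theorem IsTempered.pderiv (hM : IsOpen M) {f : State d → ℝ} (hf : IsTempered M V f) (i : Fin d) :
    IsTempered M V (pderiv i f) :=
  ((hf.const_family (A := (univ : Set Unit))).pderiv hM i).isTempered_image (mem_univ ())

theorem IsTemperedFamily.comp_compactSupport (hM : IsOpen M) (hV : ∀ x ∈ M, 1 ≤ V x)
    (hφ : IsTemperedFamily M V (φ '' A)) {θ : ℝ → ℝ} (hθ : ContDiff ℝ ∞ θ)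
    (hθc : HasCompactSupport θ) : IsTemperedFamily M V ((fun a x => θ (φ a x)) '' A) := by
  refine isTemperedFamily_image_iff.2
    ⟨fun a ha => hθ.comp_contDiffOn (hφ.isTempered_image ha).contDiffOn, fun n => ?_⟩
  have hbd : ∀ i : ℕ, ∃ C : ℝ, ∀ y, ‖iteratedFDeriv ℝ i θ y‖ ≤ C := fun i =>
    (hθc.iteratedFDeriv i).exists_bound_of_continuous
      (hθ.continuous_iteratedFDeriv (by exact_mod_cast le_top))
  choose B hB using hbd
  obtain ⟨k, C, hC, hb⟩ := hφ.exists_bound_le hV n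
  refine ⟨k * n, n.factorial * (∑ i ∈ Finset.range (n + 1), B i) * (1 + C) ^ n,
    fun a ha x hx => ?_⟩
  have hV1 := hV x hx
  have hBn : ∀ i, 0 ≤ B i := fun i => (norm_nonneg _).trans (hB i 0)
  -- The Faà di Bruno estimate asks for a bound `D ^ i` on the derivative of order `i ≥ 1`. Taking
  -- `1 + C` in place of `C` makes `D ≥ 1`, so that `D ≤ D ^ i`.
  have hone : 1 ≤ (1 + C) * V x ^ k :=
    one_le_mul_of_one_le_of_one_le (by linarith) (one_le_pow₀ hV1)
  have h := norm_iteratedFDerivWithin_comp_le (n := n) (N := ∞) (g := θ) (f := φ a) (s := M)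
    (t := univ) (x := x) hθ.contDiffOn (hφ.isTempered_image ha).contDiffOn
    (by exact_mod_cast le_top) uniqueDiffOn_univ hM.uniqueDiffOn (mapsTo_univ _ _) hx
    (C := ∑ i ∈ Finset.range (n + 1), B i) (D := (1 + C) * V x ^ k)
    (fun i hi => by
      rw [iteratedFDerivWithin_univ]
      exact (hB i _).trans (Finset.single_le_sum (fun i _ => hBn i) (by simp; omega)))
    (fun i h1 hi => by
      rw [iteratedFDerivWithin_of_isOpen _ hM hx]
      calc _ ≤ C * V x ^ k := hb i hi _ (mem_image_of_mem _ ha) x hx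
        _ ≤ (1 + C) * V x ^ k := by gcongr; linarith
        _ ≤ _ := le_self_pow₀ hone (by omega))
  rw [iteratedFDerivWithin_of_isOpen _ hM hx] at h
  refine h.trans (le_of_eq ?_)
  rw [mul_pow, ← pow_mul]; ring

end TemperedFamilies

/-! ### Truncation along level sets of the weight -/

section Truncation

variable {d : ℕ} {M : Set (State d)} {V : State d → ℝ} {α : Type*} {A : Set α}
  {φ ψ : α → State d → ℝ}

theorem IsTemperedFamily.congr (hM : IsOpen M) (h : IsTemperedFamily M V (φ '' A))
    (hφψ : ∀ a ∈ A, EqOn (ψ a) (φ a) M) : IsTemperedFamily M V (ψ '' A) := by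
  rw [isTemperedFamily_image_iff] at h ⊢
  refine ⟨fun a ha => (h.1 a ha).congr (hφψ a ha), fun n => ?_⟩
  obtain ⟨k, C, hC⟩ := h.2 n
  refine ⟨k, C, fun a ha x hx => ?_⟩
  have : ψ a =ᶠ[𝓝 x] φ a := (hφψ a ha).eventuallyEq_of_mem (hM.mem_nhds hx)
  rw [this.iteratedFDeriv ℝ n |>.eq_of_nhds]
  exact hC a ha x hx

/-- A smooth cutoff: `1` where `|V| ≤ n + 1` and `0` where `|V| ≥ 2 (n + 1)`. -/
noncomputable def weightCutoff (V : State d → ℝ) (n : ℕ) (x : State d) : ℝ :=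
  (⟨1, 2, one_pos, one_lt_two⟩ : ContDiffBump (0 : ℝ)) (((n : ℝ) + 1)⁻¹ * V x)

/-- The rescaled weights `V / (n + 1)` form a bounded family because the factor is at most `1`, and
composing with one fixed bump keeps the bounds independent of `n`. -/
theorem isTemperedFamily_weightCutoff (hM : IsOpen M) (hV : IsWeight M V) :
    IsTemperedFamily M V (weightCutoff V '' univ) := by
  have hc : IsTemperedFamily M V ((fun (n : ℕ) (_ : State d) => ((n : ℝ) + 1)⁻¹) '' univ) := by
    refine isTemperedFamily_image_iff.2 ⟨fun _ _ => contDiffOn_const, fun m => ⟨0, 1, ?_⟩⟩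
    intro n _ x _
    rcases m with _ | m
    · simp only [norm_iteratedFDeriv_zero, pow_zero, mul_one, Real.norm_eq_abs]
      rw [abs_of_pos (by positivity)]
      exact inv_le_one_of_one_le₀ (by linarith [(Nat.cast_nonneg n : (0 : ℝ) ≤ n)])
    · rw [iteratedFDeriv_const_of_ne (by omega)]; simp
  exact (hc.mul hM hV.one_le hV.tempered.const_family).comp_compactSupport hM hV.one_le
    (ContDiffBump.contDiff _) (ContDiffBump.hasCompactSupport _)

theorem weightCutoff_eq_one {n : ℕ} {x : State d} (h0 : 0 ≤ V x) (h : V x ≤ n + 1) :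
    weightCutoff V n x = 1 := by
  refine ContDiffBump.one_of_mem_closedBall _ ?_
  rw [mem_closedBall_zero_iff, Real.norm_eq_abs, abs_of_nonneg (by positivity)]
  exact (inv_mul_le_one₀ (by positivity)).2 h

theorem le_of_weightCutoff_ne_zero {n : ℕ} {x : State d} (h : weightCutoff V n x ≠ 0) :
    V x ≤ 2 * (n + 1) := by
  by_contra hlt
  push Not at hlt
  refine h (ContDiffBump.zero_of_le_dist _ ?_)
  rw [dist_zero_right, Real.norm_eq_abs]
  refine le_trans ?_ (le_abs_self _)
  rw [inv_mul_eq_div, le_div_iff₀ (by positivity)]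
  exact hlt.le

/-- The product of `f` with a cutoff, extended by zero outside `M`. -/
noncomputable def truncate (M : Set (State d)) (V f : State d → ℝ) (n : ℕ) : State d → ℝ :=
  M.indicator fun x => weightCutoff V n x * f x

/-- A sublevel set of `V` is compact, hence closed in the whole space, so the support stays away
from the boundary of `M`. This is what makes the extension by zero smooth. -/
theorem tsupport_truncate_subset (hV : IsWeight M V) (f : State d → ℝ) (n : ℕ) :
    tsupport (truncate M V f n) ⊆ {x | x ∈ M ∧ V x ≤ 2 * (n + 1)} := by
  refine closure_minimal (fun x hx => ?_) (hV.isCompact _).isClosed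
  rw [Function.mem_support, truncate, indicator_apply_ne_zero] at hx
  exact ⟨hx.1, le_of_weightCutoff_ne_zero (left_ne_zero_of_mul hx.2)⟩

theorem tsupport_truncate_subset_domain (hV : IsWeight M V) (f : State d → ℝ) (n : ℕ) :
    tsupport (truncate M V f n) ⊆ M :=
  (tsupport_truncate_subset hV f n).trans fun _ hx => hx.1

theorem hasCompactSupport_truncate (hV : IsWeight M V) (f : State d → ℝ) (n : ℕ) :
    HasCompactSupport (truncate M V f n) :=
  (hV.isCompact _).of_isClosed_subset (isClosed_tsupport _) (tsupport_truncate_subset hV f n)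

theorem isTemperedFamily_truncate (hM : IsOpen M) (hV : IsWeight M V) {f : State d → ℝ}
    (hf : IsTempered M V f) : IsTemperedFamily M V (truncate M V f '' univ) :=
  ((isTemperedFamily_weightCutoff hM hV).mul hM hV.one_le hf.const_family).congr hM
    fun _ _ _ hx => indicator_of_mem hx _

theorem contDiff_truncate (hM : IsOpen M) (hV : IsWeight M V) {f : State d → ℝ}
    (hf : IsTempered M V f) (n : ℕ) : ContDiff ℝ ∞ (truncate M V f n) := by
  refine contDiff_iff_contDiffAt.2 fun x => ?_
  by_cases hx : x ∈ M
  · exact ((isTemperedFamily_truncate hM hV hf).isTempered_image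
      (mem_univ n)).contDiffOn.contDiffAt (hM.mem_nhds hx)
  · have : truncate M V f n =ᶠ[𝓝 x] fun _ => 0 :=
      notMem_tsupport_iff_eventuallyEq.1 fun h => hx (tsupport_truncate_subset_domain hV f n h)
    exact contDiffAt_const.congr_of_eventuallyEq this

theorem truncate_eventuallyEq (hM : IsOpen M) (hV : IsWeight M V) (f : State d → ℝ) {n : ℕ}
    {x : State d} (hx : x ∈ M) (h : V x < n + 1) : truncate M V f n =ᶠ[𝓝 x] f := by
  have hc : ContinuousAt V x := hV.tempered.contDiffOn.continuousOn.continuousAt (hM.mem_nhds hx)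
  filter_upwards [hM.mem_nhds hx, hc.eventually_lt_const h] with y hy hlt
  rw [truncate, indicator_of_mem hy, weightCutoff_eq_one (by linarith [hV.one_le y hy]) hlt.le,
    one_mul]

/-- Local operators that preserve bounded families of tempered observables. -/
structure IsTemperedOp (M : Set (State d)) (V : State d → ℝ)
    (D : (State d → ℝ) → State d → ℝ) : Prop where
  congr : ∀ x ∈ M, ∀ f g : State d → ℝ, f =ᶠ[𝓝 x] g → D f x = D g x
  image : ∀ S, IsTemperedFamily M V S → IsTemperedFamily M V (D '' S)

theorem IsTemperedOp.tempered {D : (State d → ℝ) → State d → ℝ} (hD : IsTemperedOp M V D)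
    {f : State d → ℝ} (hf : IsTempered M V f) : IsTempered M V (D f) :=
  (hD.image _ hf).isTempered (mem_image_of_mem _ rfl)

/-- Truncation converges to the identity on tempered observables, at rate `1/n` in a weighted
norm, and so does its image under a local operator. -/
theorem IsTemperedOp.exists_truncate_sub_le (hM : IsOpen M) (hV : IsWeight M V)
    {D : (State d → ℝ) → State d → ℝ} (hD : IsTemperedOp M V D) {f : State d → ℝ}
    (hf : IsTempered M V f) :
    ∃ (k : ℕ) (C : ℝ), 0 ≤ C ∧ ∀ (n : ℕ), ∀ x ∈ M,
      |D (truncate M V f n) x - D f x| ≤ C / (n + 1) * V x ^ k := by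
  obtain ⟨k, C, hC, hb⟩ := (hD.image _ (isTemperedFamily_truncate hM hV hf)).exists_abs_le hV.one_le
  obtain ⟨l, B, hB, hc⟩ := (hD.tempered hf).exists_abs_le hV.one_le
  -- The error vanishes where `V < n + 1`. Elsewhere `1 ≤ V / (n + 1)`, so one extra power of `V`
  -- buys the rate.
  refine ⟨k + l + 1, C + B, by positivity, fun n x hx => ?_⟩
  have hV1 := hV.one_le x hx
  by_cases h : V x < n + 1
  · rw [hD.congr x hx _ _ (truncate_eventuallyEq hM hV f hx h), sub_self, abs_zero]
    positivity
  · push Not at h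
    have h1 := hb _ (mem_image_of_mem D (mem_image_of_mem (truncate M V f) (mem_univ n))) x hx
    have h2 := hc x hx
    calc _ ≤ C * V x ^ k + B * V x ^ l := (abs_sub _ _).trans (add_le_add h1 h2)
      _ ≤ C * V x ^ (k + l) + B * V x ^ (k + l) := by
        gcongr <;> first | assumption | omega
      _ = (C + B) / (n + 1) * (V x ^ (k + l) * (n + 1)) := by field_simp
      _ ≤ (C + B) / (n + 1) * (V x ^ (k + l) * V x) := by gcongr
      _ = _ := by rw [pow_succ]

theorem Filter.EventuallyEq.pderiv {f g : State d → ℝ} {x : State d} (h : f =ᶠ[𝓝 x] g)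
    (i : Fin d) : pderiv i f =ᶠ[𝓝 x] pderiv i g := by
  filter_upwards [h.fderiv (𝕜 := ℝ)] with y hy
  simp only [_root_.pderiv, hy]

/-- The operator `F̃ᵢ ∂ᵢ`. -/
noncomputable def driftOp (F' : Fin d → State d → ℝ) (i : Fin d) (f : State d → ℝ)
    (x : State d) : ℝ :=
  F' i x * pderiv i f x

/-- The operator `σ̃ᵢ² ∂ᵢ²`. -/
noncomputable def diffusionOp (σ' : Fin d → State d → ℝ) (i : Fin d) (f : State d → ℝ)
    (x : State d) : ℝ :=
  σ' i x ^ 2 * pderiv i (pderiv i f) x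

/-- With the identity among the operators, the truncation estimates for `D f` also cover `f` itself.
-/
theorem isTemperedOp_id : IsTemperedOp M V fun f => f :=
  ⟨fun _ _ _ _ h => h.eq_of_nhds, fun S hS => by simpa using hS⟩

theorem isTemperedOp_driftOp (hM : IsOpen M) (hV : ∀ x ∈ M, 1 ≤ V x)
    {F' : Fin d → State d → ℝ} (hF' : ∀ i, IsTempered M V (F' i)) (i : Fin d) :
    IsTemperedOp M V (driftOp F' i) := by
  refine ⟨fun x _ f g h => ?_, fun S hS => ?_⟩
  · simp only [driftOp, (h.pderiv i).eq_of_nhds]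
  · have hS' : IsTemperedFamily M V ((fun f => f) '' S) := by simpa using hS
    exact (hF' i).const_family.mul hM hV (hS'.pderiv hM i)

theorem isTemperedOp_diffusionOp (hM : IsOpen M) (hV : ∀ x ∈ M, 1 ≤ V x)
    {σ' : Fin d → State d → ℝ} (hσ' : ∀ i, IsTempered M V (σ' i)) (i : Fin d) :
    IsTemperedOp M V (diffusionOp σ' i) := by
  refine ⟨fun x _ f g h => ?_, fun S hS => ?_⟩
  · simp only [diffusionOp, ((h.pderiv i).pderiv i).eq_of_nhds]
  · have hS' : IsTemperedFamily M V ((fun f => f) '' S) := by simpa using hS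
    exact ((hσ' i).pow hM hV 2).const_family.mul hM hV ((hS'.pderiv hM i).pderiv hM i)

theorem isTemperedOp_generator (hM : IsOpen M) (hV : ∀ x ∈ M, 1 ≤ V x)
    {F σ : Fin d → State d → ℝ} (hF : ∀ i, IsTempered M V (F i))
    (hσ : ∀ i, IsTempered M V (σ i)) : IsTemperedOp M V (generator F σ) := by
  refine ⟨fun x _ f g h => ?_, fun S hS => ?_⟩
  · simp only [generator, kolmogorovOp, (h.pderiv _).eq_of_nhds,
      ((h.pderiv _).pderiv _).eq_of_nhds]
  · have hS' : IsTemperedFamily M V ((fun f => f) '' S) := by simpa using hS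
    exact hS'.kolmogorovOp hM hV hF fun i => (hσ i).pow hM hV 2

/-- Time enters only through scalar factors in front of fixed operators, so regularity in time of
the averages needs to be studied for fixed observables only. -/
theorem perturbedGenerator_apply (F σ F' σ' : Fin d → State d → ℝ) (G H : Fin d → ℝ → ℝ)
    (δ t : ℝ) (f : State d → ℝ) (x : State d) :
    perturbedGenerator F σ F' σ' G H δ t f x = generator F σ f x
      + δ * ∑ i, (G i t * driftOp F' i f x + H i t ^ 2 * diffusionOp σ' i f x) := by
  simp only [perturbedGenerator, generator, kolmogorovOp, driftOp, diffusionOp, Finset.mul_sum,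
    ← Finset.sum_add_distrib]
  exact Finset.sum_congr rfl fun i _ => by ring

end Truncation

/-! ### Integrability from moments of the weight -/

section Moments

variable {d : ℕ} {M : Set (State d)} {V : State d → ℝ}

theorem aestronglyMeasurable_of_continuousOn (hM : IsOpen M) {ν : Measure (State d)}
    (hν : ν Mᶜ = 0) {f : State d → ℝ} (hf : ContinuousOn f M) : AEStronglyMeasurable f ν := by
  have : ν.restrict M = ν := Measure.restrict_eq_self_of_ae_mem (mem_ae_iff.2 hν)
  rw [← this]
  exact hf.aestronglyMeasurable hM.measurableSet

theorem integrable_of_abs_le (hM : IsOpen M) {ν : Measure (State d)}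
    (hν : ν Mᶜ = 0) {f g : State d → ℝ} (hf : ContinuousOn f M) (hg : Integrable g ν)
    (h : ∀ x ∈ M, |f x| ≤ g x) : Integrable f ν :=
  hg.mono' (aestronglyMeasurable_of_continuousOn hM hν hf) <| by
    filter_upwards [mem_ae_iff.2 hν] with x hx using h x hx

theorem IsTempered.integrable (hM : IsOpen M) (hV : ∀ x ∈ M, 1 ≤ V x) {ν : Measure (State d)}
    (hν : ν Mᶜ = 0) (hmom : ∀ k : ℕ, Integrable (fun x => V x ^ k) ν) {f : State d → ℝ}
    (hf : IsTempered M V f) : Integrable f ν := by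
  obtain ⟨k, C, -, hb⟩ := hf.exists_abs_le hV
  exact integrable_of_abs_le hM hν hf.contDiffOn.continuousOn ((hmom k).const_mul C) hb

theorem abs_integral_le_of_abs_le {ν : Measure (State d)}
    (hν : ν Mᶜ = 0) {f g : State d → ℝ} (hg : Integrable g ν)
    (h : ∀ x ∈ M, |f x| ≤ g x) : |∫ x, f x ∂ν| ≤ ∫ x, g x ∂ν :=
  norm_integral_le_of_norm_le (f := f) hg <| by
    filter_upwards [mem_ae_iff.2 hν] with x hx using h x hx

/-- All moments of `V` are bounded on bounded time intervals. -/
def HasBoundedMoments (V : State d → ℝ) (μ : ℝ → Measure (State d)) : Prop :=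
  ∀ (k : ℕ) (T : ℝ), ∃ C : ℝ, ∀ t ∈ Icc 0 T,
    Integrable (fun x => V x ^ k) (μ t) ∧ ∫ x, V x ^ k ∂(μ t) ≤ C

theorem HasBoundedMoments.integrable {μ : ℝ → Measure (State d)} (h : HasBoundedMoments V μ)
    {t : ℝ} (ht : 0 ≤ t) (k : ℕ) : Integrable (fun x => V x ^ k) (μ t) := by
  obtain ⟨C, hC⟩ := h k t
  exact (hC t ⟨ht, le_rfl⟩).1

end Moments

theorem tendsto_const_div_add_one_atTop (C : ℝ) :
    Tendsto (fun n : ℕ => C / ((n : ℝ) + 1)) atTop (𝓝 0) := by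
  simpa [div_eq_mul_inv] using
    (tendsto_one_div_add_atTop_nhds_zero_nat (𝕜 := ℝ)).const_mul C

theorem intervalIntegrable_fun_sum {ι : Type*} (u : Finset ι) {f : ι → ℝ → ℝ} {a b : ℝ}
    (h : ∀ i ∈ u, IntervalIntegrable (f i) volume a b) :
    IntervalIntegrable (fun s => ∑ i ∈ u, f i s) volume a b := by
  simpa only [Finset.sum_fn] using IntervalIntegrable.sum u h

/-! ### The forward equation for tempered observables -/

section ForwardEquation

variable {d : ℕ} {M : Set (State d)} {V : State d → ℝ}

/-- The pointwise rate carries a power of `V`; a moment bound on `[0, T]` turns it into a rate for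
the integrals, uniform in time. -/
theorem HasBoundedMoments.exists_abs_integral_truncate_sub_le (hM : IsOpen M) (hV : IsWeight M V)
    {μ : ℝ → Measure (State d)} (hmem : ∀ t, 0 ≤ t → μ t Mᶜ = 0) (hμV : HasBoundedMoments V μ)
    {D : (State d → ℝ) → State d → ℝ} (hD : IsTemperedOp M V D) {f : State d → ℝ}
    (hf : IsTempered M V f) (T : ℝ) :
    ∃ C : ℝ, 0 ≤ C ∧ ∀ n : ℕ, ∀ t ∈ Icc 0 T,
      |∫ x, D (truncate M V f n) x ∂(μ t) - ∫ x, D f x ∂(μ t)| ≤ C / (n + 1) := by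
  obtain ⟨k, C, hC, hb⟩ := hD.exists_truncate_sub_le hM hV hf
  obtain ⟨B, hB⟩ := hμV k T
  refine ⟨C * |B|, by positivity, fun n t ht => ?_⟩
  have hint : ∀ g, IsTempered M V g → Integrable g (μ t) := fun g hg =>
    hg.integrable hM hV.one_le (hmem t ht.1) (fun k => hμV.integrable ht.1 k)
  rw [← integral_sub
    (hint _ (hD.tempered ((isTemperedFamily_truncate hM hV hf).isTempered_image (mem_univ n))))
    (hint _ (hD.tempered hf))]
  refine (abs_integral_le_of_abs_le (hmem t ht.1) ((hB t ht).1.const_mul (C / (n + 1)))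
    (hb n)).trans ?_
  rw [integral_const_mul]
  calc C / (n + 1) * ∫ x, V x ^ k ∂(μ t) ≤ C / (n + 1) * |B| := by
        gcongr; exact (hB t ht).2.trans (le_abs_self _)
    _ = _ := by ring

/-- The weak equation exhibits the average as a constant plus the primitive of an integrable
function. -/
theorem IsFokkerPlanckSolution.continuousOn_integral_of_compactSupport
    {B : ℝ → (State d → ℝ) → State d → ℝ} {μ₀ : Measure (State d)} {μ : ℝ → Measure (State d)}
    (hμ : IsFokkerPlanckSolution M B μ₀ μ) {f : State d → ℝ} (hf : ContDiff ℝ ∞ f)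
    (hfc : HasCompactSupport f) (hfM : tsupport f ⊆ M) (T : ℝ) :
    ContinuousOn (fun t => ∫ x, f x ∂(μ t)) (Icc 0 T) := by
  rcases lt_or_ge T 0 with hT | hT
  · rw [Icc_eq_empty (not_le.2 hT)]; exact continuousOn_empty _
  have h := hμ.weak f hf hfc hfM
  have hc : ContinuousOn (fun t => ∫ x, f x ∂μ₀ + ∫ s in (0 : ℝ)..t, ∫ x, B s f x ∂(μ s))
      (Icc 0 T) := by
    refine continuousOn_const.add ?_
    have := intervalIntegral.continuousOn_primitive_interval
      (μ := volume) (a := 0) (b := T) (f := fun s => ∫ x, B s f x ∂(μ s)) (by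
        have := (h T hT).1
        rw [intervalIntegrable_iff_integrableOn_Icc_of_le hT] at this
        rwa [uIcc_of_le hT])
    rwa [uIcc_of_le hT] at this
  exact hc.congr fun t ht => (h t ht.1).2

/-- The averages of the truncations are continuous and converge uniformly on `[0, T]`. -/
theorem IsFokkerPlanckSolution.continuousOn_integral (hM : IsOpen M) (hV : IsWeight M V)
    {B : ℝ → (State d → ℝ) → State d → ℝ} {μ₀ : Measure (State d)} {μ : ℝ → Measure (State d)}
    (hμ : IsFokkerPlanckSolution M B μ₀ μ) (hμV : HasBoundedMoments V μ) {f : State d → ℝ}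
    (hf : IsTempered M V f) (T : ℝ) :
    ContinuousOn (fun t => ∫ x, f x ∂(μ t)) (Icc 0 T) := by
  obtain ⟨C, -, hb⟩ :=
    hμV.exists_abs_integral_truncate_sub_le hM hV hμ.mem isTemperedOp_id hf T
  have hlim : TendstoUniformlyOn (fun (n : ℕ) t => ∫ x, truncate M V f n x ∂(μ t))
      (fun t => ∫ x, f x ∂(μ t)) atTop (Icc 0 T) := by
    rw [Metric.tendstoUniformlyOn_iff]
    intro ε hε
    filter_upwards [(tendsto_const_div_add_one_atTop C).eventually_lt_const hε] with n hn t ht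
    rw [dist_comm, Real.dist_eq]
    exact (hb n t ht).trans_lt hn
  exact hlim.continuousOn <| (Eventually.of_forall fun n =>
    hμ.continuousOn_integral_of_compactSupport (contDiff_truncate hM hV hf n)
      (hasCompactSupport_truncate hV f n) (tsupport_truncate_subset_domain hV f n) T).frequently

/-- The rate of change of `∫ f dμ` along a solution of the perturbed Fokker-Planck equation. -/
noncomputable def forwardRate (F σ F' σ' : Fin d → State d → ℝ) (G H : Fin d → ℝ → ℝ) (δ : ℝ)
    (ν : Measure (State d)) (f : State d → ℝ) (s : ℝ) : ℝ :=
  ∫ x, generator F σ f x ∂ν + δ * ∑ i, (G i s * ∫ x, driftOp F' i f x ∂ν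
    + H i s ^ 2 * ∫ x, diffusionOp σ' i f x ∂ν)

theorem intervalIntegrable_forwardRate {F σ F' σ' : Fin d → State d → ℝ} {G H : Fin d → ℝ → ℝ}
    {δ : ℝ} {μ : ℝ → Measure (State d)} {f : State d → ℝ} {t : ℝ} (ht : 0 ≤ t)
    (hG : ∀ i, IntervalIntegrable (G i) volume 0 t)
    (hH : ∀ i, IntervalIntegrable (fun s => H i s ^ 2) volume 0 t)
    (h0 : ContinuousOn (fun s => ∫ x, generator F σ f x ∂(μ s)) (Icc 0 t))
    (h1 : ∀ i, ContinuousOn (fun s => ∫ x, driftOp F' i f x ∂(μ s)) (Icc 0 t))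
    (h2 : ∀ i, ContinuousOn (fun s => ∫ x, diffusionOp σ' i f x ∂(μ s)) (Icc 0 t)) :
    IntervalIntegrable (fun s => forwardRate F σ F' σ' G H δ (μ s) f s) volume 0 t := by
  rw [← uIcc_of_le ht] at h0 h1 h2
  exact h0.intervalIntegrable.add (IntervalIntegrable.const_mul
    (intervalIntegrable_fun_sum _ fun i _ =>
      ((hG i).mul_continuousOn (h1 i)).add ((hH i).mul_continuousOn (h2 i))) δ)

theorem integral_perturbedGenerator (hM : IsOpen M) (hV : IsWeight M V)
    {F σ F' σ' : Fin d → State d → ℝ} {G H : Fin d → ℝ → ℝ} {δ s : ℝ}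
    (hF : ∀ i, IsTempered M V (F i)) (hσ : ∀ i, IsTempered M V (σ i))
    (hF' : ∀ i, IsTempered M V (F' i)) (hσ' : ∀ i, IsTempered M V (σ' i))
    {ν : Measure (State d)} (hν : ν Mᶜ = 0) (hmom : ∀ k : ℕ, Integrable (fun x => V x ^ k) ν)
    {f : State d → ℝ} (hf : IsTempered M V f) :
    ∫ x, perturbedGenerator F σ F' σ' G H δ s f x ∂ν = forwardRate F σ F' σ' G H δ ν f s := by
  have hint : ∀ g, IsTempered M V g → Integrable g ν := fun g hg =>
    hg.integrable hM hV.one_le hν hmom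
  have h0 := hint _ ((isTemperedOp_generator hM hV.one_le hF hσ).tempered hf)
  have h1 := fun i => hint _ ((isTemperedOp_driftOp hM hV.one_le hF' i).tempered hf)
  have h2 := fun i => hint _ ((isTemperedOp_diffusionOp hM hV.one_le hσ' i).tempered hf)
  simp only [perturbedGenerator_apply, forwardRate]
  have h12 : ∀ i, Integrable
      (fun x => G i s * driftOp F' i f x + H i s ^ 2 * diffusionOp σ' i f x) ν :=
    fun i => ((h1 i).const_mul (G i s)).add ((h2 i).const_mul (H i s ^ 2))
  rw [integral_add h0 ((integrable_finsetSum _ fun i _ => h12 i).const_mul δ),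
    integral_const_mul, integral_finsetSum _ fun i _ => h12 i]
  congr 2
  refine Finset.sum_congr rfl fun i _ => ?_
  rw [integral_add ((h1 i).const_mul _) ((h2 i).const_mul _), integral_const_mul,
    integral_const_mul]

/-- The forward equation of the perturbed system holds for tempered observables. -/
theorem IsFokkerPlanckSolution.integral_eq_of_tempered (hM : IsOpen M) (hV : IsWeight M V)
    {F σ F' σ' : Fin d → State d → ℝ} {G H : Fin d → ℝ → ℝ} {δ : ℝ}
    (hF : ∀ i, IsTempered M V (F i)) (hσ : ∀ i, IsTempered M V (σ i))
    (hF' : ∀ i, IsTempered M V (F' i)) (hσ' : ∀ i, IsTempered M V (σ' i))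
    (hG : ∀ i, ∀ t, 0 ≤ t → IntervalIntegrable (G i) volume 0 t)
    (hH : ∀ i, ∀ t, 0 ≤ t → IntervalIntegrable (fun s => H i s ^ 2) volume 0 t)
    {μ₀ : Measure (State d)} {μ : ℝ → Measure (State d)}
    (hμ : IsFokkerPlanckSolution M (perturbedGenerator F σ F' σ' G H δ) μ₀ μ)
    (hμV : HasBoundedMoments V μ) {f : State d → ℝ} (hf : IsTempered M V f)
    {t : ℝ} (ht : 0 ≤ t) :
    IntervalIntegrable (fun s => forwardRate F σ F' σ' G H δ (μ s) f s) volume 0 t ∧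
    ∫ x, f x ∂(μ t) = ∫ x, f x ∂μ₀
      + ∫ s in (0 : ℝ)..t, forwardRate F σ F' σ' G H δ (μ s) f s := by
  have op0 := isTemperedOp_generator hM hV.one_le hF hσ
  have op1 := fun i => isTemperedOp_driftOp hM hV.one_le hF' i
  have op2 := fun i => isTemperedOp_diffusionOp hM hV.one_le hσ' i
  have hcont : ∀ g, IsTempered M V g → ContinuousOn (fun s => ∫ x, g x ∂(μ s)) (Icc 0 t) :=
    fun g hg => hμ.continuousOn_integral hM hV hμV hg t
  have hint : ∀ g, IsTempered M V g →
      IntervalIntegrable (fun s => forwardRate F σ F' σ' G H δ (μ s) g s) volume 0 t :=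
    fun g hg => intervalIntegrable_forwardRate ht (fun i => hG i t ht) (fun i => hH i t ht)
      (hcont _ (op0.tempered hg)) (fun i => hcont _ ((op1 i).tempered hg))
      (fun i => hcont _ ((op2 i).tempered hg))
  refine ⟨hint f hf, ?_⟩
  have htr : ∀ n, IsTempered M V (truncate M V f n) := fun n =>
    (isTemperedFamily_truncate hM hV hf).isTempered_image (mem_univ n)
  have heq : ∀ n, ∫ x, truncate M V f n x ∂(μ t) = ∫ x, truncate M V f n x ∂μ₀
      + ∫ s in (0 : ℝ)..t, forwardRate F σ F' σ' G H δ (μ s) (truncate M V f n) s := by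
    intro n
    rw [(hμ.weak _ (contDiff_truncate hM hV hf n) (hasCompactSupport_truncate hV f n)
      (tsupport_truncate_subset_domain hV f n) t ht).2]
    congr 1
    refine intervalIntegral.integral_congr fun s hs => ?_
    rw [uIcc_of_le ht] at hs
    exact integral_perturbedGenerator hM hV hF hσ hF' hσ' (hμ.mem s hs.1)
      (fun k => hμV.integrable hs.1 k) (htr n)
  have herr : ∀ {D : (State d → ℝ) → State d → ℝ}, IsTemperedOp M V D → ∃ C : ℝ, 0 ≤ C ∧
      ∀ n : ℕ, ∀ s ∈ Icc 0 t,
        |∫ x, D (truncate M V f n) x ∂(μ s) - ∫ x, D f x ∂(μ s)| ≤ C / (n + 1) :=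
    fun hD => hμV.exists_abs_integral_truncate_sub_le hM hV hμ.mem hD hf t
  have hlim : ∀ s ∈ Icc 0 t, Tendsto (fun n => ∫ x, truncate M V f n x ∂(μ s)) atTop
      (𝓝 (∫ x, f x ∂(μ s))) := by
    intro s hs
    obtain ⟨C, -, hC⟩ := herr isTemperedOp_id
    exact tendsto_iff_dist_tendsto_zero.2 (squeeze_zero (fun _ => dist_nonneg)
      (fun n => hC n s hs) (tendsto_const_div_add_one_atTop C))
  obtain ⟨C0, hC0, hb0⟩ := herr op0
  choose C1 hC1 hb1 using fun i => herr (op1 i)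
  choose C2 hC2 hb2 using fun i => herr (op2 i)
  -- The truncation error of the rate at time `s` is at most `m s / (n + 1)`. As `m` is integrable,
  -- the time integrals converge although the coefficients may be unbounded.
  set m : ℝ → ℝ := fun s => C0 + |δ| * ∑ i, (|G i s| * C1 i + H i s ^ 2 * C2 i) with hm
  have hmi : IntervalIntegrable m volume 0 t := by
    exact intervalIntegrable_const.add (IntervalIntegrable.const_mul
      (intervalIntegrable_fun_sum _ fun i _ =>
        ((hG i t ht).abs.mul_const (C1 i)).add ((hH i t ht).mul_const (C2 i))) _)
  have hrate : ∀ n : ℕ, ∀ s ∈ Icc 0 t, |forwardRate F σ F' σ' G H δ (μ s) (truncate M V f n) s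
      - forwardRate F σ F' σ' G H δ (μ s) f s| ≤ m s / (n + 1) := by
    intro n s hs
    rw [forwardRate, forwardRate, add_sub_add_comm, ← mul_sub, ← Finset.sum_sub_distrib, hm,
      add_div, mul_div_assoc, Finset.sum_div]
    refine (abs_add_le _ _).trans (add_le_add (hb0 n s hs) ?_)
    rw [abs_mul]
    refine mul_le_mul_of_nonneg_left ((Finset.abs_sum_le_sum_abs _ _).trans
      (Finset.sum_le_sum fun i _ => ?_)) (abs_nonneg _)
    rw [add_sub_add_comm, ← mul_sub, ← mul_sub, add_div, mul_div_assoc, mul_div_assoc]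
    refine (abs_add_le _ _).trans (add_le_add ?_ ?_)
    · rw [abs_mul]
      exact mul_le_mul_of_nonneg_left (hb1 i n s hs) (abs_nonneg _)
    · rw [abs_mul, abs_of_nonneg (sq_nonneg (H i s))]
      exact mul_le_mul_of_nonneg_left (hb2 i n s hs) (sq_nonneg _)
  have hI : Tendsto (fun n => ∫ s in (0 : ℝ)..t,
      forwardRate F σ F' σ' G H δ (μ s) (truncate M V f n) s) atTop
      (𝓝 (∫ s in (0 : ℝ)..t, forwardRate F σ F' σ' G H δ (μ s) f s)) := by
    refine tendsto_iff_dist_tendsto_zero.2 (squeeze_zero (fun _ => dist_nonneg)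
      (fun n => ?_) (tendsto_const_div_add_one_atTop (∫ s in (0 : ℝ)..t, m s)))
    rw [Real.dist_eq, ← intervalIntegral.integral_sub (hint _ (htr n)) (hint f hf),
      ← intervalIntegral.integral_div]
    exact (intervalIntegral.norm_integral_le_of_norm_le (f := fun s =>
      forwardRate F σ F' σ' G H δ (μ s) (truncate M V f n) s
      - forwardRate F σ F' σ' G H δ (μ s) f s) ht
      (ae_of_all _ fun s hs => hrate n s ⟨hs.1.le, hs.2⟩) (hmi.div_const _))
  have hl0 := hlim 0 ⟨le_rfl, ht⟩
  rw [hμ.initial] at hl0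
  refine tendsto_nhds_unique (hlim t ⟨ht, le_rfl⟩) ?_
  simp only [heq]
  exact hl0.add hI

theorem IsFokkerPlanckSolution.integral_sub_integral_of_tempered (hM : IsOpen M)
    (hV : IsWeight M V) {F σ F' σ' : Fin d → State d → ℝ} {G H : Fin d → ℝ → ℝ} {δ : ℝ}
    (hF : ∀ i, IsTempered M V (F i)) (hσ : ∀ i, IsTempered M V (σ i))
    (hF' : ∀ i, IsTempered M V (F' i)) (hσ' : ∀ i, IsTempered M V (σ' i))
    (hG : ∀ i, ∀ t, 0 ≤ t → IntervalIntegrable (G i) volume 0 t)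
    (hH : ∀ i, ∀ t, 0 ≤ t → IntervalIntegrable (fun s => H i s ^ 2) volume 0 t)
    {μ₀ : Measure (State d)} {μ : ℝ → Measure (State d)}
    (hμ : IsFokkerPlanckSolution M (perturbedGenerator F σ F' σ' G H δ) μ₀ μ)
    (hμV : HasBoundedMoments V μ) {f : State d → ℝ} (hf : IsTempered M V f)
    {s t : ℝ} (hs : 0 ≤ s) (ht : 0 ≤ t) :
    IntervalIntegrable (fun r => forwardRate F σ F' σ' G H δ (μ r) f r) volume s t ∧
    ∫ x, f x ∂(μ t) - ∫ x, f x ∂(μ s)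
      = ∫ r in s..t, forwardRate F σ F' σ' G H δ (μ r) f r := by
  have h1 := hμ.integral_eq_of_tempered hM hV hF hσ hF' hσ' hG hH hμV hf ht
  have h2 := hμ.integral_eq_of_tempered hM hV hF hσ hF' hσ' hG hH hμV hf hs
  refine ⟨h2.1.symm.trans h1.1, ?_⟩
  rw [h1.2, h2.2, ← intervalIntegral.integral_interval_sub_left h1.1 h2.1]
  ring

end ForwardEquation

/-! ### The Markov semigroup and its expansion for short times -/

theorem integral_measure_bind_kernel {X Y : Type*} [MeasurableSpace X] [MeasurableSpace Y]
    {ν : Measure X} {κ : Kernel X Y} {f : Y → ℝ} (hf : Integrable f (ν.bind κ)) :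
    ∫ y, f y ∂(ν.bind κ) = ∫ x, ∫ y, f y ∂(κ x) ∂ν := by
  have h : (κ ∘ₖ Kernel.const Unit ν) () = ν.bind κ := by simp
  rw [← h] at hf ⊢
  simpa using Kernel.integral_comp hf

section Semigroup

variable {d : ℕ} {M : Set (State d)} {V : State d → ℝ} {F σ : Fin d → State d → ℝ}
  {κ : ℝ → Kernel (State d) (State d)}

theorem ActsOnTempered.exists_abs_semigroup_le (hV : ∀ x ∈ M, 1 ≤ V x)
    (hκV : ActsOnTempered M V κ) {S : Set (State d → ℝ)} (hS : IsTemperedFamily M V S) (T : ℝ) :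
    ∃ (k : ℕ) (C : ℝ), 0 ≤ C ∧ ∀ f ∈ S, ∀ t ∈ Icc 0 T, ∀ x ∈ M,
      |semigroup κ t f x| ≤ C * V x ^ k := by
  obtain ⟨k, C, hC, hb⟩ := (hκV.bounded S hS T).exists_abs_le hV
  exact ⟨k, C, hC, fun f hf t ht x hx => hb _ ⟨f, hf, t, ht, rfl⟩ x hx⟩

theorem ActsOnTempered.isTempered_semigroup (hκV : ActsOnTempered M V κ) {f : State d → ℝ}
    (hf : IsTempered M V f) {t : ℝ} (ht : 0 ≤ t) : IsTempered M V (semigroup κ t f) :=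
  (hκV.bounded _ hf t).isTempered ⟨f, rfl, t, ⟨ht, le_rfl⟩, rfl⟩

theorem ActsOnTempered.hasBoundedMoments (hM : IsOpen M) (hV : IsWeight M V)
    (hκV : ActsOnTempered M V κ) {x : State d} (hx : x ∈ M) :
    HasBoundedMoments V fun t => κ t x := by
  intro k T
  have hVk := hV.tempered.pow hM hV.one_le k
  obtain ⟨l, C, -, hC⟩ := hκV.exists_abs_semigroup_le hV.one_le hVk T
  exact ⟨C * V x ^ l, fun t ht => ⟨hκV.integrable _ hVk t ht.1 x hx,
    (le_abs_self _).trans (hC _ rfl t ht x hx)⟩⟩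

/-- The transition probabilities are the case of zero perturbation, so the extension to tempered
observables applies to them as well. -/
theorem IsTransitionFunction.forward_perturbed (hκ : IsTransitionFunction M (generator F σ) κ)
    {x : State d} (hx : x ∈ M) :
    IsFokkerPlanckSolution M (perturbedGenerator F σ 0 0 0 0 0) (Measure.dirac x)
      fun t => κ t x := by
  have : perturbedGenerator F σ 0 0 0 0 0 = fun _ => generator F σ := by
    ext t f x
    simp [perturbedGenerator_apply]
  rw [this]
  exact hκ.forward x hx

/-- The Kolmogorov forward equation `e^{tK} f = f + ∫₀ᵗ e^{sK} K f ds` for tempered `f`. -/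
theorem IsTransitionFunction.semigroup_sub_eq (hM : IsOpen M) (hV : IsWeight M V)
    (hF : ∀ i, IsTempered M V (F i)) (hσ : ∀ i, IsTempered M V (σ i))
    (hκ : IsTransitionFunction M (generator F σ) κ) (hκV : ActsOnTempered M V κ)
    {f : State d → ℝ} (hf : IsTempered M V f) {x : State d} (hx : x ∈ M) {t : ℝ} (ht : 0 ≤ t) :
    IntervalIntegrable (fun s => semigroup κ s (generator F σ f) x) volume 0 t ∧
    semigroup κ t f x - f x = ∫ s in (0 : ℝ)..t, semigroup κ s (generator F σ f) x := by
  have h0 : ∀ i : Fin d, IsTempered M V ((0 : Fin d → State d → ℝ) i) := fun _ =>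
    isTempered_const 0
  have h := (hκ.forward_perturbed hx).integral_eq_of_tempered hM hV hF hσ h0 h0
    (fun i t _ => intervalIntegrable_const (c := (0 : ℝ)))
    (fun i t _ => by simp)
    (hκV.hasBoundedMoments hM hV hx) hf ht
  simp only [forwardRate, zero_mul, add_zero] at h
  refine ⟨h.1, ?_⟩
  rw [semigroup, h.2, integral_dirac, add_sub_cancel_left]
  rfl

theorem IsTransitionFunction.exists_abs_semigroup_sub_le (hM : IsOpen M) (hV : IsWeight M V)
    (hF : ∀ i, IsTempered M V (F i)) (hσ : ∀ i, IsTempered M V (σ i))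
    (hκ : IsTransitionFunction M (generator F σ) κ) (hκV : ActsOnTempered M V κ)
    {S : Set (State d → ℝ)} (hS : IsTemperedFamily M V S) (T : ℝ) :
    ∃ (k : ℕ) (C : ℝ), 0 ≤ C ∧ ∀ f ∈ S, ∀ t ∈ Icc 0 T, ∀ x ∈ M,
      |semigroup κ t f x - f x| ≤ C * t * V x ^ k := by
  obtain ⟨k, C, hC, hb⟩ := hκV.exists_abs_semigroup_le hV.one_le
    ((isTemperedOp_generator hM hV.one_le hF hσ).image S hS) T
  refine ⟨k, C, hC, fun f hf t ht x hx => ?_⟩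
  rw [(hκ.semigroup_sub_eq hM hV hF hσ hκV (hS.isTempered hf) hx ht.1).2]
  have := intervalIntegral.norm_integral_le_of_norm_le_const (a := 0) (b := t)
    (f := fun s => semigroup κ s (generator F σ f) x) (C := C * V x ^ k) (fun s hs => by
      rw [uIoc_of_le ht.1] at hs
      exact hb _ (mem_image_of_mem _ hf) s ⟨hs.1.le, hs.2.trans ht.2⟩ x hx)
  rw [sub_zero, abs_of_nonneg ht.1] at this
  exact this.trans_eq (by ring)

/-- The remainder is `∫₀ᵗ (P_s - 1) K f ds`. The first-order bound holds for the family of all `K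
f`, which is again bounded, and integrating it gives the second power of `t`. -/
theorem IsTransitionFunction.exists_abs_semigroup_sub_sub_le (hM : IsOpen M) (hV : IsWeight M V)
    (hF : ∀ i, IsTempered M V (F i)) (hσ : ∀ i, IsTempered M V (σ i))
    (hκ : IsTransitionFunction M (generator F σ) κ) (hκV : ActsOnTempered M V κ)
    {S : Set (State d → ℝ)} (hS : IsTemperedFamily M V S) (T : ℝ) :
    ∃ (k : ℕ) (C : ℝ), 0 ≤ C ∧ ∀ f ∈ S, ∀ t ∈ Icc 0 T, ∀ x ∈ M,
      |semigroup κ t f x - f x - t * generator F σ f x| ≤ C * t ^ 2 * V x ^ k := by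
  obtain ⟨k, C, hC, hb⟩ := hκ.exists_abs_semigroup_sub_le hM hV hF hσ hκV
    ((isTemperedOp_generator hM hV.one_le hF hσ).image S hS) T
  refine ⟨k, C, hC, fun f hf t ht x hx => ?_⟩
  obtain ⟨hi, he⟩ := hκ.semigroup_sub_eq hM hV hF hσ hκV (hS.isTempered hf) hx ht.1
  have hconst : t * generator F σ f x = ∫ _ in (0 : ℝ)..t, generator F σ f x := by simp
  rw [he, hconst, ← intervalIntegral.integral_sub hi intervalIntegrable_const]
  have hV1 := hV.one_le x hx
  have := intervalIntegral.norm_integral_le_of_norm_le_const (a := 0) (b := t)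
    (f := fun s => semigroup κ s (generator F σ f) x - generator F σ f x)
    (C := C * t * V x ^ k) (fun s hs => by
      rw [uIoc_of_le ht.1] at hs
      refine (hb _ (mem_image_of_mem _ hf) s ⟨hs.1.le, hs.2.trans ht.2⟩ x hx).trans ?_
      gcongr
      exact hs.2)
  rw [sub_zero, abs_of_nonneg ht.1] at this
  exact this.trans_eq (by ring)

theorem IsTransitionFunction.semigroup_add {B : (State d → ℝ) → State d → ℝ}
    (hκ : IsTransitionFunction M B κ) (hκV : ActsOnTempered M V κ)
    {f : State d → ℝ} (hf : IsTempered M V f) {s t : ℝ} (hs : 0 ≤ s) (ht : 0 ≤ t)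
    {x : State d} (hx : x ∈ M) :
    semigroup κ (s + t) f x = semigroup κ s (semigroup κ t f) x := by
  have h := hκV.integrable f hf (s + t) (add_nonneg hs ht) x hx
  rw [semigroup]
  rw [hκ.chapman s t hs ht x hx] at h ⊢
  exact integral_measure_bind_kernel h

/-- Invariance equates `ν` with `ν.bind (κ t)`, and the integral against the latter is an iterated
one. -/
theorem integral_semigroup_of_invariant {ν : Measure (State d)} {t : ℝ}
    (h : Kernel.Invariant (κ t) ν) {f : State d → ℝ} (hf : Integrable f ν) :
    ∫ x, semigroup κ t f x ∂ν = ∫ x, f x ∂ν := by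
  rw [← h.def] at hf
  conv_rhs => rw [← h.def]
  exact (integral_measure_bind_kernel hf).symm

theorem integral_densityMeasure (hM : IsOpen M) {ρ : State d → ℝ}
    (hρ : ContinuousOn ρ M) (hpos : ∀ x ∈ M, 0 < ρ x) (f : State d → ℝ) :
    ∫ x, f x ∂(densityMeasure M ρ) = steadyAverage M ρ f := by
  rw [densityMeasure, integral_withDensity_eq_integral_toReal_smul₀
    (hρ.aemeasurable hM.measurableSet).ennreal_ofReal (ae_of_all _ fun _ => ENNReal.ofReal_lt_top)]
  refine setIntegral_congr_fun hM.measurableSet fun x hx => ?_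
  simp only [ENNReal.toReal_ofReal (hpos x hx).le, smul_eq_mul, mul_comm]

theorem integrable_densityMeasure_iff (hM : IsOpen M) {ρ : State d → ℝ}
    (hρ : ContinuousOn ρ M) (hpos : ∀ x ∈ M, 0 < ρ x) {f : State d → ℝ} :
    Integrable f (densityMeasure M ρ) ↔ IntegrableOn (fun x => f x * ρ x) M := by
  rw [densityMeasure, integrable_withDensity_iff_integrable_smul₀'
    (hρ.aemeasurable hM.measurableSet).ennreal_ofReal (ae_of_all _ fun _ => ENNReal.ofReal_lt_top)]
  refine integrableOn_congr_fun (fun x hx => ?_) hM.measurableSet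
  simp only [ENNReal.toReal_ofReal (hpos x hx).le, smul_eq_mul, mul_comm]

theorem densityMeasure_compl (hM : IsOpen M) (ρ : State d → ℝ) : densityMeasure M ρ Mᶜ = 0 :=
  (withDensity_absolutelyContinuous _ _) (by simp [Measure.restrict_apply hM.measurableSet.compl])

theorem DecaysAtBoundary.integrable_pow (hM : IsOpen M) {ρ : State d → ℝ}
    (hρV : DecaysAtBoundary M V ρ) (hρ : ContinuousOn ρ M) (hpos : ∀ x ∈ M, 0 < ρ x) (k : ℕ) :
    Integrable (fun x => V x ^ k) (densityMeasure M ρ) := by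
  rw [integrable_densityMeasure_iff hM hρ hpos]
  refine (integrableOn_congr_fun (fun x hx => ?_) hM.measurableSet).1 (hρV k 0 (by norm_num))
  simp [abs_of_pos (hpos x hx)]

end Semigroup

/-! ### Integration by parts without boundary terms -/

section IntegrationByParts

variable {d : ℕ} {M : Set (State d)} {V : State d → ℝ}

theorem isTemperedOp_pderiv (hM : IsOpen M) (i : Fin d) :
    IsTemperedOp M V (pderiv i) := by
  refine ⟨fun x _ f g h => (h.pderiv i).eq_of_nhds, fun S hS => ?_⟩
  have hS' : IsTemperedFamily M V ((fun f => f) '' S) := by simpa using hS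
  exact hS'.pderiv hM i

/-- Smooth functions on `M` that are integrable against all powers of the weight. -/
structure IsRapidlyIntegrable (M : Set (State d)) (V a : State d → ℝ) : Prop where
  smooth : ContDiffOn ℝ ∞ a M
  integrable : ∀ k : ℕ, IntegrableOn (fun x => V x ^ k * |a x|) M

theorem integrableOn_of_abs_le (hM : IsOpen M) {f g : State d → ℝ} (hf : ContinuousOn f M)
    (hg : IntegrableOn g M) (h : ∀ x ∈ M, |f x| ≤ g x) : IntegrableOn f M :=
  hg.mono' (hf.aestronglyMeasurable hM.measurableSet) <| by
    filter_upwards [ae_restrict_mem hM.measurableSet] with x hx using h x hx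

theorem IsRapidlyIntegrable.congr (hM : IsOpen M) {a b : State d → ℝ}
    (ha : IsRapidlyIntegrable M V a) (h : EqOn b a M) : IsRapidlyIntegrable M V b :=
  ⟨ha.smooth.congr h, fun k => (ha.integrable k).congr_fun
    (fun x hx => by simp only [h hx]) hM.measurableSet⟩

/-- A tempered factor costs a power of `V`, and integrability is available against every power. -/
theorem IsRapidlyIntegrable.mul (hM : IsOpen M) (hV : IsWeight M V) {a f : State d → ℝ}
    (ha : IsRapidlyIntegrable M V a) (hf : IsTempered M V f) :
    IsRapidlyIntegrable M V fun x => f x * a x := by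
  refine ⟨hf.contDiffOn.mul ha.smooth, fun k => ?_⟩
  obtain ⟨l, C, hC, hb⟩ := hf.exists_abs_le hV.one_le
  refine integrableOn_of_abs_le hM
    ((hV.tempered.contDiffOn.continuousOn.pow k).mul
      (hf.contDiffOn.mul ha.smooth).continuousOn.abs)
    ((ha.integrable (k + l)).const_mul C) fun x hx => ?_
  have := hV.one_le x hx
  rw [abs_mul, abs_abs, abs_mul, abs_of_nonneg (by positivity : 0 ≤ V x ^ k)]
  calc _ ≤ V x ^ k * (C * V x ^ l * |a x|) := by gcongr; exact hb x hx
    _ = _ := by ring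

theorem IsRapidlyIntegrable.add (hM : IsOpen M) (hV : IsWeight M V) {a b : State d → ℝ}
    (ha : IsRapidlyIntegrable M V a) (hb : IsRapidlyIntegrable M V b) :
    IsRapidlyIntegrable M V fun x => a x + b x := by
  refine ⟨ha.smooth.add hb.smooth, fun k => ?_⟩
  refine integrableOn_of_abs_le hM
    ((hV.tempered.contDiffOn.continuousOn.pow k).mul
      (ha.smooth.add hb.smooth).continuousOn.abs)
    ((ha.integrable k).add (hb.integrable k)) fun x hx => ?_
  have := hV.one_le x hx
  rw [abs_mul, abs_abs, abs_of_nonneg (by positivity : 0 ≤ V x ^ k), Pi.add_apply, ← mul_add]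
  gcongr
  exact abs_add_le _ _

theorem IsRapidlyIntegrable.integrableOn (hM : IsOpen M) {a : State d → ℝ}
    (ha : IsRapidlyIntegrable M V a) : IntegrableOn a M :=
  integrableOn_of_abs_le hM ha.smooth.continuousOn (by simpa using ha.integrable 0)
    fun _ _ => le_rfl

theorem IsRapidlyIntegrable.abs_setIntegral_mul_le (hM : IsOpen M) {a f : State d → ℝ}
    (ha : IsRapidlyIntegrable M V a) {k : ℕ} {C : ℝ} (hf : ∀ x ∈ M, |f x| ≤ C * V x ^ k) :
    |∫ x in M, f x * a x| ≤ C * ∫ x in M, V x ^ k * |a x| := by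
  rw [← integral_const_mul]
  refine norm_integral_le_of_norm_le (f := fun x => f x * a x) ((ha.integrable k).const_mul C) ?_
  filter_upwards [ae_restrict_mem hM.measurableSet] with x hx
  rw [Real.norm_eq_abs, abs_mul, ← mul_assoc]
  exact mul_le_mul_of_nonneg_right (hf x hx) (abs_nonneg _)

theorem IsRapidlyIntegrable.tendsto_setIntegral_truncate (hM : IsOpen M) (hV : IsWeight M V)
    {a : State d → ℝ} (ha : IsRapidlyIntegrable M V a) {D : (State d → ℝ) → State d → ℝ}
    (hD : IsTemperedOp M V D) {f : State d → ℝ} (hf : IsTempered M V f) :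
    Tendsto (fun n => ∫ x in M, D (truncate M V f n) x * a x) atTop
      (𝓝 (∫ x in M, D f x * a x)) := by
  obtain ⟨k, C, -, hb⟩ := hD.exists_truncate_sub_le hM hV hf
  refine tendsto_iff_dist_tendsto_zero.2 (squeeze_zero (fun _ => dist_nonneg) (fun n => ?_)
    (tendsto_const_div_add_one_atTop (C * ∫ x in M, V x ^ k * |a x|)))
  have hint : ∀ g, IsTempered M V g → IntegrableOn (fun x => g x * a x) M := fun g hg =>
    (ha.mul hM hV hg).integrableOn hM
  rw [Real.dist_eq, ← integral_sub
    (hint _ (hD.tempered ((isTemperedFamily_truncate hM hV hf).isTempered_image (mem_univ n))))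
    (hint _ (hD.tempered hf))]
  simp only [← sub_mul]
  exact (ha.abs_setIntegral_mul_le hM (hb n)).trans_eq (by ring)

theorem pderiv_eq_zero_of_notMem_tsupport {f : State d → ℝ} {x : State d} (hx : x ∉ tsupport f)
    (i : Fin d) : pderiv i f x = 0 := by
  simp [pderiv, fderiv_of_notMem_tsupport ℝ hx]

/-- Integration by parts on `M`: the boundary terms vanish. -/
theorem integral_pderiv_mul_eq_neg (hM : IsOpen M) (hV : IsWeight M V) {a : State d → ℝ}
    {i : Fin d} (ha : IsRapidlyIntegrable M V a) (ha' : IsRapidlyIntegrable M V (pderiv i a))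
    {w : State d → ℝ} (hw : IsTempered M V w) :
    ∫ x in M, pderiv i w x * a x = -∫ x in M, w x * pderiv i a x := by
  refine tendsto_nhds_unique (ha.tendsto_setIntegral_truncate hM hV (isTemperedOp_pderiv hM i) hw)
    (((ha'.tendsto_setIntegral_truncate hM hV isTemperedOp_id hw).neg).congr fun n => ?_)
  set g := truncate M V w n with hg
  have hgM : tsupport g ⊆ M := tsupport_truncate_subset_domain hV w n
  have hgt : IsTempered M V g :=
    (isTemperedFamily_truncate hM hV hw).isTempered_image (mem_univ n)
  have h0 : ∀ x ∉ M, g x = 0 := fun x hx => image_eq_zero_of_notMem_tsupport fun h => hx (hgM h)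
  have h1 : ∀ x ∉ M, pderiv i g x = 0 := fun x hx =>
    pderiv_eq_zero_of_notMem_tsupport (fun h => hx (hgM h)) i
  have hext : ∀ {f : State d → ℝ}, (∀ x ∉ M, f x = 0) → IntegrableOn f M → Integrable f :=
    fun hf hi => (integrableOn_iff_integrable_of_support_subset
      (Function.support_subset_iff'.2 hf)).1 hi
  -- The truncation `g` is supported inside `M`, so the formula on the whole space applies: `a` has
  -- to be differentiable only on the support of `g`, and its values outside `M` play no role.
  have key := integral_mul_fderiv_eq_neg_fderiv_mul_of_integrable (μ := volume) (f := a) (g := g)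
    (v := (EuclideanSpace.single i 1 : State d))
    (hext (fun x hx => by simp [h0 x hx])
      ((ha'.mul hM hV hgt).integrableOn hM |>.congr_fun (fun x _ => mul_comm _ _)
        hM.measurableSet))
    (hext (fun x hx => mul_eq_zero_of_right _ (h1 x hx))
      ((ha.mul hM hV (hgt.pderiv hM i)).integrableOn hM |>.congr_fun (fun x _ => mul_comm _ _)
        hM.measurableSet))
    (hext (fun x hx => by simp [h0 x hx])
      ((ha.mul hM hV hgt).integrableOn hM |>.congr_fun (fun x _ => mul_comm _ _)
        hM.measurableSet))
    (fun x hx => (ha.smooth.contDiffAt (hM.mem_nhds (hgM hx))).differentiableAt (by simp))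
    (fun x _ => (contDiff_truncate hM hV hw n).differentiable (by simp) x)
  rw [setIntegral_eq_integral_of_forall_compl_eq_zero (fun x hx => by simp [h0 x hx]),
    setIntegral_eq_integral_of_forall_compl_eq_zero (fun x hx => by simp [h1 x hx])]
  simp only [mul_comm (g _), mul_comm (pderiv i g _)]
  exact key.symm

theorem pderiv_mul (hM : IsOpen M) {f g : State d → ℝ} (hf : ContDiffOn ℝ ∞ f M)
    (hg : ContDiffOn ℝ ∞ g M) (i : Fin d) {x : State d} (hx : x ∈ M) :
    pderiv i (fun y => f y * g y) x = f x * pderiv i g x + pderiv i f x * g x := by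
  have h1 := (hf.contDiffAt (hM.mem_nhds hx)).differentiableAt (by simp)
  have h2 := (hg.contDiffAt (hM.mem_nhds hx)).differentiableAt (by simp)
  simp only [pderiv]
  rw [fderiv_fun_mul h1 h2]
  simp [mul_comm]

theorem IsRapidlyIntegrable.pderiv_mul (hM : IsOpen M) (hV : IsWeight M V) {a f : State d → ℝ}
    {i : Fin d} (ha : IsRapidlyIntegrable M V a) (ha' : IsRapidlyIntegrable M V (pderiv i a))
    (hf : IsTempered M V f) : IsRapidlyIntegrable M V (pderiv i fun x => f x * a x) :=
  ((ha'.mul hM hV hf).add hM hV (ha.mul hM hV (hf.pderiv hM i))).congr hM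
    fun _ hx => _root_.pderiv_mul hM hf.contDiffOn ha.smooth i hx

end IntegrationByParts

/-! ### Adjoints of the perturbing operators with respect to the steady state -/

section SteadyState

variable {d : ℕ} {M : Set (State d)} {V ρ : State d → ℝ}

theorem DecaysAtBoundary.isRapidlyIntegrable (hM : IsOpen M) (hV : IsWeight M V)
    (h : DecaysAtBoundary M V ρ) {a : State d → ℝ}
    (ha : ContDiffOn ℝ ∞ a M) {n : ℕ} (hn : n ≤ 2)
    (hb : ∀ x ∈ M, |a x| ≤ ‖iteratedFDeriv ℝ n ρ x‖) : IsRapidlyIntegrable M V a := by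
  refine ⟨ha, fun k => integrableOn_of_abs_le hM
    ((hV.tempered.contDiffOn.continuousOn.pow k).mul ha.continuousOn.abs) (h k n hn)
    fun x hx => ?_⟩
  have := hV.one_le x hx
  rw [abs_mul, abs_abs, abs_of_nonneg (by positivity : 0 ≤ V x ^ k)]
  gcongr
  exact hb x hx

theorem DecaysAtBoundary.density (hM : IsOpen M) (hV : IsWeight M V)
    (hρ : ContDiffOn ℝ ∞ ρ M) (h : DecaysAtBoundary M V ρ) : IsRapidlyIntegrable M V ρ :=
  h.isRapidlyIntegrable hM hV hρ (n := 0) (by norm_num) fun x _ => by simp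

theorem DecaysAtBoundary.pderiv (hM : IsOpen M) (hV : IsWeight M V)
    (hρ : ContDiffOn ℝ ∞ ρ M) (h : DecaysAtBoundary M V ρ) (i : Fin d) :
    IsRapidlyIntegrable M V (pderiv i ρ) :=
  h.isRapidlyIntegrable hM hV (contDiffOn_pderiv hM hρ i) (n := 1) (by norm_num) fun x hx => by
    simpa using norm_iteratedFDeriv_pderiv_le hM hρ i 0 hx

theorem DecaysAtBoundary.pderiv_pderiv (hM : IsOpen M) (hV : IsWeight M V)
    (hρ : ContDiffOn ℝ ∞ ρ M) (h : DecaysAtBoundary M V ρ) (i : Fin d) :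
    IsRapidlyIntegrable M V (_root_.pderiv i (_root_.pderiv i ρ)) :=
  h.isRapidlyIntegrable hM hV (contDiffOn_pderiv hM (contDiffOn_pderiv hM hρ i) i) (n := 2)
    (by norm_num) fun x hx => by
    simpa using (norm_iteratedFDeriv_pderiv_le hM (contDiffOn_pderiv hM hρ i) i 0 hx).trans
      (norm_iteratedFDeriv_pderiv_le hM hρ i 1 hx)

theorem driftResponse_mul (hpos : ∀ x ∈ M, 0 < ρ x) (F' : Fin d → State d → ℝ) (i : Fin d)
    {x : State d} (hx : x ∈ M) :
    driftResponse ρ F' i x * ρ x = _root_.pderiv i (fun y => F' i y * ρ y) x := by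
  have := (hpos x hx).ne'
  rw [driftResponse]; field_simp

theorem noiseResponse_mul (hM : IsOpen M) (hρ : ContDiffOn ℝ ∞ ρ M) (hpos : ∀ x ∈ M, 0 < ρ x)
    {σ' : Fin d → State d → ℝ} (i : Fin d) (hσ' : ContDiffOn ℝ ∞ (σ' i) M)
    {x : State d} (hx : x ∈ M) :
    noiseResponse ρ σ' i x * ρ x
      = _root_.pderiv i (_root_.pderiv i fun y => σ' i y ^ 2 * ρ y) x := by
  have h2 : ContDiffOn ℝ ∞ (fun y => σ' i y ^ 2) M := hσ'.pow 2
  -- The first product rule is needed on a neighbourhood because its result is differentiated again.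
  -- The two mixed terms then combine into the coefficient `2`.
  have hev : _root_.pderiv i (fun y => σ' i y ^ 2 * ρ y) =ᶠ[𝓝 x] fun y =>
      σ' i y ^ 2 * _root_.pderiv i ρ y + _root_.pderiv i (fun z => σ' i z ^ 2) y * ρ y := by
    filter_upwards [hM.mem_nhds hx] with y hy using pderiv_mul hM h2 hρ i hy
  have hadd : _root_.pderiv i (fun y =>
      σ' i y ^ 2 * _root_.pderiv i ρ y + _root_.pderiv i (fun z => σ' i z ^ 2) y * ρ y) x
      = _root_.pderiv i (fun y => σ' i y ^ 2 * _root_.pderiv i ρ y) x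
        + _root_.pderiv i (fun y => _root_.pderiv i (fun z => σ' i z ^ 2) y * ρ y) x := by
    have e1 := ((h2.mul (contDiffOn_pderiv hM hρ i)).contDiffAt
      (hM.mem_nhds hx)).differentiableAt (by simp)
    have e2 := (((contDiffOn_pderiv hM h2 i).mul hρ).contDiffAt
      (hM.mem_nhds hx)).differentiableAt (by simp)
    simp only [_root_.pderiv] at e1 e2 ⊢
    rw [fderiv_fun_add e1 e2]
    rfl
  rw [(hev.pderiv i).eq_of_nhds, hadd, pderiv_mul hM h2 (contDiffOn_pderiv hM hρ i) i hx,
    pderiv_mul hM (contDiffOn_pderiv hM h2 i) hρ i hx, noiseResponse]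
  have := (hpos x hx).ne'
  field_simp
  ring

theorem isRapidlyIntegrable_driftResponse (hM : IsOpen M) (hV : IsWeight M V)
    (hρ : ContDiffOn ℝ ∞ ρ M) (hpos : ∀ x ∈ M, 0 < ρ x) (hρV : DecaysAtBoundary M V ρ)
    {F' : Fin d → State d → ℝ} {i : Fin d} (hF' : IsTempered M V (F' i)) :
    IsRapidlyIntegrable M V fun x => driftResponse ρ F' i x * ρ x :=
  ((hρV.density hM hV hρ).pderiv_mul hM hV (hρV.pderiv hM hV hρ i) hF').congr hM
    fun _ hx => driftResponse_mul hpos F' i hx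

theorem isRapidlyIntegrable_noiseResponse (hM : IsOpen M) (hV : IsWeight M V)
    (hρ : ContDiffOn ℝ ∞ ρ M) (hpos : ∀ x ∈ M, 0 < ρ x) (hρV : DecaysAtBoundary M V ρ)
    {σ' : Fin d → State d → ℝ} {i : Fin d} (hσ' : IsTempered M V (σ' i)) :
    IsRapidlyIntegrable M V fun x => noiseResponse ρ σ' i x * ρ x := by
  have h2 : IsTempered M V fun x => σ' i x ^ 2 := hσ'.pow hM hV.one_le 2
  have r0 := hρV.density hM hV hρ
  have r1 := hρV.pderiv hM hV hρ i
  have r2 := hρV.pderiv_pderiv hM hV hρ i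
  have two := (isTempered_const (M := M) (V := V) 2).mul hM hV.one_le (h2.pderiv hM i)
  refine (((r0.mul hM hV ((h2.pderiv hM i).pderiv hM i)).add hM hV
    (r1.mul hM hV two)).add hM hV (r2.mul hM hV h2)).congr hM fun x hx => ?_
  have := (hpos x hx).ne'
  simp only [noiseResponse]
  field_simp

/-- One derivative is moved onto `F̃ᵢ ρ`, whence the minus sign; dividing and multiplying by `ρ > 0`
turns the result back into a steady state average. -/
theorem steadyAverage_driftOp (hM : IsOpen M) (hV : IsWeight M V)
    (hρ : ContDiffOn ℝ ∞ ρ M) (hpos : ∀ x ∈ M, 0 < ρ x) (hρV : DecaysAtBoundary M V ρ)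
    {F' : Fin d → State d → ℝ} {i : Fin d} (hF' : IsTempered M V (F' i)) {w : State d → ℝ}
    (hw : IsTempered M V w) :
    steadyAverage M ρ (driftOp F' i w)
      = -steadyAverage M ρ fun x => driftResponse ρ F' i x * w x := by
  have r0 := hρV.density hM hV hρ
  have r1 := hρV.pderiv hM hV hρ i
  have h := integral_pderiv_mul_eq_neg hM hV (r0.mul hM hV hF') (r0.pderiv_mul hM hV r1 hF') hw
  have e1 : steadyAverage M ρ (driftOp F' i w)
      = ∫ x in M, _root_.pderiv i w x * (F' i x * ρ x) := by
    simp only [steadyAverage, driftOp]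
    congr 1; ext x; ring
  rw [e1, h, steadyAverage]
  congr 1
  refine setIntegral_congr_fun hM.measurableSet fun x hx => ?_
  simp only [← driftResponse_mul hpos F' i hx]
  ring

/-- Two derivatives are moved onto `σ̃ᵢ² ρ`, and the two signs cancel. -/
theorem steadyAverage_diffusionOp (hM : IsOpen M) (hV : IsWeight M V)
    (hρ : ContDiffOn ℝ ∞ ρ M) (hpos : ∀ x ∈ M, 0 < ρ x) (hρV : DecaysAtBoundary M V ρ)
    {σ' : Fin d → State d → ℝ} {i : Fin d} (hσ' : IsTempered M V (σ' i)) {w : State d → ℝ}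
    (hw : IsTempered M V w) :
    steadyAverage M ρ (diffusionOp σ' i w)
      = steadyAverage M ρ fun x => noiseResponse ρ σ' i x * w x := by
  have h2 : IsTempered M V fun x => σ' i x ^ 2 := hσ'.pow hM hV.one_le 2
  have r0 := hρV.density hM hV hρ
  have r1 := r0.pderiv_mul hM hV (hρV.pderiv hM hV hρ i) h2
  have r2 : IsRapidlyIntegrable M V
      (_root_.pderiv i (_root_.pderiv i fun y => σ' i y ^ 2 * ρ y)) :=
    (isRapidlyIntegrable_noiseResponse hM hV hρ hpos hρV hσ').congr hM fun x hx =>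
      (noiseResponse_mul hM hρ hpos i hσ'.contDiffOn hx).symm
  have e1 : steadyAverage M ρ (diffusionOp σ' i w)
      = ∫ x in M, _root_.pderiv i (_root_.pderiv i w) x * (σ' i x ^ 2 * ρ x) := by
    simp only [steadyAverage, diffusionOp]
    congr 1; ext x; ring
  rw [e1, integral_pderiv_mul_eq_neg hM hV (r0.mul hM hV h2) r1 (hw.pderiv hM i),
    integral_pderiv_mul_eq_neg hM hV r1 r2 hw, neg_neg, steadyAverage]
  refine setIntegral_congr_fun hM.measurableSet fun x hx => ?_
  simp only [← noiseResponse_mul hM hρ hpos i hσ'.contDiffOn hx]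
  ring

end SteadyState

/-- Local increments of size `a ∫ m` up to errors that vanish under refinement add up. -/
theorem abs_sub_le_of_local_increment_le {Ψ m : ℝ → ℝ} {t a c : ℝ} (ht : 0 ≤ t)
    (hm : IntervalIntegrable m volume 0 t)
    (h : ∀ s s', 0 ≤ s → s ≤ s' → s' ≤ t →
      |Ψ s' - Ψ s| ≤ a * (∫ r in s..s', m r) + c * (s' - s) * ∫ r in s..s', m r) :
    |Ψ t - Ψ 0| ≤ a * ∫ r in (0 : ℝ)..t, m r := by
  -- For a partition into `n + 1` equal pieces the error terms share the factor `c t / (n + 1)` and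
  -- their integrals add up to `∫₀ᵗ m`. No smoothness of `Ψ` is needed.
  have hlim : Tendsto (fun n : ℕ => a * (∫ r in (0 : ℝ)..t, m r)
      + (c * t * ∫ r in (0 : ℝ)..t, m r) / ((n : ℝ) + 1)) atTop
      (𝓝 (a * ∫ r in (0 : ℝ)..t, m r)) := by
    simpa using (tendsto_const_div_add_one_atTop (c * t * ∫ r in (0 : ℝ)..t, m r)).const_add
      (a * ∫ r in (0 : ℝ)..t, m r)
  refine ge_of_tendsto' hlim fun n => ?_
  set N : ℝ := (n : ℝ) + 1 with hN
  have hNpos : 0 < N := by positivity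
  set p : ℕ → ℝ := fun j => j * (t / N) with hp
  have hp0 : p 0 = 0 := by simp [hp]
  have hpN : p (n + 1) = t := by
    simp only [hp, Nat.cast_add, Nat.cast_one, ← hN]; field_simp
  have hh : 0 ≤ t / N := by positivity
  have hstep : ∀ j, p (j + 1) - p j = t / N := fun j => by
    simp only [hp, Nat.cast_add, Nat.cast_one]; ring
  have hmono : Monotone p := monotone_nat_of_le_succ fun j => by linarith [hstep j]
  have hge : ∀ j, 0 ≤ p j := fun j => by simp only [hp]; positivity
  have hle : ∀ j, j ≤ n + 1 → p j ≤ t := fun j hj => (hmono hj).trans_eq hpN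
  have hint : ∀ j < n + 1, IntervalIntegrable m volume (p j) (p (j + 1)) := fun j hj =>
    hm.mono_set (by
      rw [uIcc_of_le (hmono (Nat.le_succ j)), uIcc_of_le ht]
      exact Icc_subset_Icc (hge j) (hle (j + 1) hj))
  have hsum := intervalIntegral.sum_integral_adjacent_intervals hint
  rw [hp0, hpN] at hsum
  calc |Ψ t - Ψ 0| = |∑ j ∈ Finset.range (n + 1), (Ψ (p (j + 1)) - Ψ (p j))| := by
        rw [Finset.sum_range_sub (fun j => Ψ (p j)), hp0, hpN]
    _ ≤ ∑ j ∈ Finset.range (n + 1), |Ψ (p (j + 1)) - Ψ (p j)| := Finset.abs_sum_le_sum_abs _ _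
    _ ≤ ∑ j ∈ Finset.range (n + 1), (a + c * (t / N)) * ∫ r in p j..p (j + 1), m r := by
        refine Finset.sum_le_sum fun j hj => ?_
        have := h (p j) (p (j + 1)) (hge j) (hmono (Nat.le_succ j))
          (hle _ (Finset.mem_range.1 hj))
        rw [hstep] at this
        linarith
    _ = (a + c * (t / N)) * ∫ r in (0 : ℝ)..t, m r := by rw [← Finset.mul_sum, hsum]
    _ = _ := by ring

/-! ### Regularity of response functions in time -/

section ResponseFunctions

variable {d : ℕ} {M : Set (State d)} {V : State d → ℝ} {F σ : Fin d → State d → ℝ}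
  {κ : ℝ → Kernel (State d) (State d)} {ρ r : State d → ℝ}

theorem steadyAverage_mul_sub (hM : IsOpen M) (hV : IsWeight M V)
    (hr : IsRapidlyIntegrable M V fun x => r x * ρ x) {f g : State d → ℝ}
    (hf : IsTempered M V f) (hg : IsTempered M V g) :
    steadyAverage M ρ (fun x => r x * f x) - steadyAverage M ρ (fun x => r x * g x)
      = ∫ x in M, (f x - g x) * (r x * ρ x) := by
  have e : ∀ f : State d → ℝ, steadyAverage M ρ (fun x => r x * f x)
      = ∫ x in M, f x * (r x * ρ x) := fun f => by
    simp only [steadyAverage]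
    congr 1; ext x; ring
  rw [e, e, ← integral_sub ((hr.mul hM hV hf).integrableOn hM) ((hr.mul hM hV hg).integrableOn hM)]
  simp only [sub_mul]

/-- Response functions are Lipschitz in time, uniformly on bounded families of observables. -/
theorem exists_abs_response_sub_le (hM : IsOpen M) (hV : IsWeight M V)
    (hF : ∀ i, IsTempered M V (F i)) (hσ : ∀ i, IsTempered M V (σ i))
    (hκ : IsTransitionFunction M (generator F σ) κ) (hκV : ActsOnTempered M V κ)
    (hr : IsRapidlyIntegrable M V fun x => r x * ρ x) {S : Set (State d → ℝ)}
    (hS : IsTemperedFamily M V S) (T : ℝ) :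
    ∃ C : ℝ, 0 ≤ C ∧ ∀ u ∈ S, ∀ p q, 0 ≤ p → p ≤ q → q ≤ T →
      |steadyAverage M ρ (fun x => r x * semigroup κ q u x)
        - steadyAverage M ρ (fun x => r x * semigroup κ p u x)| ≤ C * (q - p) := by
  obtain ⟨k, C, hC, hb⟩ :=
    -- As `P_q u - P_p u = (P_{q-p} - 1) P_p u`, the first-order bound is wanted for the whole
    -- bounded family of functions `P_p u`.
    hκ.exists_abs_semigroup_sub_le hM hV hF hσ hκV (hκV.bounded S hS T) T
  have hI : 0 ≤ ∫ x in M, V x ^ k * |r x * ρ x| :=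
    setIntegral_nonneg hM.measurableSet fun x hx => by
      have := hV.one_le x hx
      positivity
  refine ⟨C * ∫ x in M, V x ^ k * |r x * ρ x|, by positivity, fun u hu p q hp hpq hq => ?_⟩
  have hut := hS.isTempered hu
  rw [steadyAverage_mul_sub hM hV hr (hκV.isTempered_semigroup hut (hp.trans hpq))
    (hκV.isTempered_semigroup hut hp)]
  refine (hr.abs_setIntegral_mul_le hM (k := k) (C := C * (q - p)) fun x hx => ?_).trans_eq
    (by ring)
  have h := hb _ ⟨u, hu, p, ⟨hp, hpq.trans hq⟩, rfl⟩ (q - p) ⟨by linarith, by linarith⟩ x hx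
  rwa [← hκ.semigroup_add hκV hut (by linarith) hp hx, sub_add_cancel] at h

theorem continuousOn_response (hM : IsOpen M) (hV : IsWeight M V)
    (hF : ∀ i, IsTempered M V (F i)) (hσ : ∀ i, IsTempered M V (σ i))
    (hκ : IsTransitionFunction M (generator F σ) κ) (hκV : ActsOnTempered M V κ)
    (hr : IsRapidlyIntegrable M V fun x => r x * ρ x) {u : State d → ℝ}
    (hu : IsTempered M V u) (t : ℝ) :
    ContinuousOn (fun s => steadyAverage M ρ (fun x => r x * semigroup κ (t - s) u x))
      (Icc 0 t) := by
  obtain ⟨C, hC, hb⟩ := exists_abs_response_sub_le hM hV hF hσ hκ hκV hr hu t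
  refine (LipschitzOnWith.of_dist_le_mul (K := C.toNNReal) fun s hs s' hs' => ?_).continuousOn
  rw [Real.dist_eq, Real.dist_eq, Real.coe_toNNReal _ hC]
  rcases le_total s s' with h | h
  · have := hb u rfl (t - s') (t - s) (by linarith [hs'.2]) (by linarith) (by linarith [hs.1])
    rwa [abs_sub_comm s s', abs_of_nonneg (sub_nonneg.2 h),
      show s' - s = t - s - (t - s') by ring]
  · have := hb u rfl (t - s) (t - s') (by linarith [hs.2]) (by linarith) (by linarith [hs'.1])
    rwa [abs_sub_comm (steadyAverage _ _ _), abs_of_nonneg (sub_nonneg.2 h),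
      show s - s' = t - s' - (t - s) by ring]

end ResponseFunctions

theorem IntervalIntegrable.mono_Icc {f : ℝ → ℝ} {a b s t : ℝ}
    (h : IntervalIntegrable f volume a b) (has : a ≤ s) (hst : s ≤ t) (htb : t ≤ b) :
    IntervalIntegrable f volume s t :=
  h.mono_set (by
    rw [uIcc_of_le hst, uIcc_of_le (has.trans (hst.trans htb))]
    exact Icc_subset_Icc has htb)

/-- Finitely many constants can be replaced by a common one. -/
theorem exists_common_bound {ι : Type*} [Fintype ι] {P : ι → ℝ → Prop}
    (hmono : ∀ i C C', C ≤ C' → P i C → P i C') (h : ∀ i, ∃ C, 0 ≤ C ∧ P i C) :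
    ∃ C, 0 ≤ C ∧ ∀ i, P i C := by
  choose C hC hP using h
  exact ⟨∑ i, C i, Finset.sum_nonneg fun i _ => hC i, fun i => hmono i _ _
    (Finset.single_le_sum (fun i _ => hC i) (Finset.mem_univ i)) (hP i)⟩

/-- The integrable majorant `1 + ∑ᵢ |Gᵢ| + Hᵢ²` of the perturbation. -/
def perturbationSize {d : ℕ} (G H : Fin d → ℝ → ℝ) (s : ℝ) : ℝ :=
  1 + ∑ i, (|G i s| + H i s ^ 2)

/-! ### The integrable majorant of the perturbation -/

section PerturbationSize

variable {d : ℕ} {G H : Fin d → ℝ → ℝ}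

/-- This is the purpose of the summand `1`: contributions of the unperturbed generator and lengths
of time intervals are absorbed into the integral of the majorant. -/
theorem one_le_perturbationSize (s : ℝ) : 1 ≤ perturbationSize G H s :=
  le_add_of_nonneg_right (Finset.sum_nonneg fun _ _ => by positivity)

theorem abs_sum_le_perturbationSize {a b : Fin d → ℝ} {c : ℝ} (hc : 0 ≤ c)
    (ha : ∀ i, |a i| ≤ c) (hb : ∀ i, |b i| ≤ c) (s : ℝ) :
    |∑ i, (G i s * a i + H i s ^ 2 * b i)| ≤ c * perturbationSize G H s := by
  rw [perturbationSize, mul_add, mul_one, Finset.mul_sum]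
  refine le_add_of_nonneg_of_le hc ((Finset.abs_sum_le_sum_abs _ _).trans
    (Finset.sum_le_sum fun i _ => (abs_add_le _ _).trans ?_))
  rw [abs_mul, abs_mul, abs_of_nonneg (sq_nonneg (H i s)), mul_add, mul_comm c, mul_comm c]
  exact add_le_add (mul_le_mul_of_nonneg_left (ha i) (abs_nonneg _))
    (mul_le_mul_of_nonneg_left (hb i) (sq_nonneg _))

theorem intervalIntegrable_perturbationSize {t : ℝ}
    (hG : ∀ i, IntervalIntegrable (G i) volume 0 t)
    (hH : ∀ i, IntervalIntegrable (fun s => H i s ^ 2) volume 0 t) :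
    IntervalIntegrable (perturbationSize G H) volume 0 t :=
  intervalIntegrable_const.add
    (intervalIntegrable_fun_sum _ fun i _ => (hG i).abs.add (hH i))

theorem sub_le_integral_perturbationSize {s t : ℝ} (hst : s ≤ t)
    (h : IntervalIntegrable (perturbationSize G H) volume s t) :
    t - s ≤ ∫ r in s..t, perturbationSize G H r := by
  have := intervalIntegral.integral_mono_on hst (intervalIntegrable_const (c := (1 : ℝ))) h
    fun r _ => one_le_perturbationSize r
  simpa using this

theorem integral_perturbationSize_mono {a b s t : ℝ} (has : a ≤ s) (hst : s ≤ t) (htb : t ≤ b)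
    (h : IntervalIntegrable (perturbationSize G H) volume a b) :
    ∫ r in s..t, perturbationSize G H r ≤ ∫ r in a..b, perturbationSize G H r :=
  intervalIntegral.integral_mono_interval has hst htb
    (ae_of_all _ fun r => zero_le_one.trans (one_le_perturbationSize r)) h

end PerturbationSize

/-- The data of the linear response theorem: a diffusion with a steady state, and a perturbation
that starts from it. -/
structure LinearResponseSetting {d : ℕ} (M : Set (State d)) (V : State d → ℝ)
    (F σ : Fin d → State d → ℝ) (κ : ℝ → Kernel (State d) (State d)) (ρ : State d → ℝ)
    (F' σ' : Fin d → State d → ℝ) (G H : Fin d → ℝ → ℝ) (δ₀ : ℝ)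
    (μ : ℝ → ℝ → Measure (State d)) : Prop where
  isOpen : IsOpen M
  weight : IsWeight M V
  drift : ∀ i, IsTempered M V (F i)
  diffusion : ∀ i, IsTempered M V (σ i)
  transition : IsTransitionFunction M (generator F σ) κ
  acts : ActsOnTempered M V κ
  steady : IsSteadyState M κ ρ
  decay : DecaysAtBoundary M V ρ
  drift' : ∀ i, IsTempered M V (F' i)
  diffusion' : ∀ i, IsTempered M V (σ' i)
  integrable_drift : ∀ i, ∀ t, 0 ≤ t → IntervalIntegrable (G i) volume 0 t
  integrable_diffusion : ∀ i, ∀ t, 0 ≤ t → IntervalIntegrable (fun s => H i s ^ 2) volume 0 t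
  solution : ∀ δ ∈ Ioc 0 δ₀, IsFokkerPlanckSolution M (perturbedGenerator F σ F' σ' G H δ)
    (densityMeasure M ρ) (μ δ)
  moments : ∀ (k : ℕ) (T : ℝ), ∃ C : ℝ, ∀ δ ∈ Ioc 0 δ₀, ∀ t ∈ Icc 0 T,
    Integrable (fun x => V x ^ k) (μ δ t) ∧ ∫ x, V x ^ k ∂(μ δ t) ≤ C

/-! ### Duhamel's formula and the bound of first order in `δ` -/

namespace LinearResponseSetting

variable {d : ℕ} {M : Set (State d)} {V : State d → ℝ} {F σ : Fin d → State d → ℝ}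
  {κ : ℝ → Kernel (State d) (State d)} {ρ : State d → ℝ} {F' σ' : Fin d → State d → ℝ}
  {G H : Fin d → ℝ → ℝ} {δ₀ : ℝ} {μ : ℝ → ℝ → Measure (State d)} {S : Set (State d → ℝ)}
  {δ t : ℝ} {f u : State d → ℝ}

theorem hasBoundedMoments (h : LinearResponseSetting M V F σ κ ρ F' σ' G H δ₀ μ)
    (hδ : δ ∈ Ioc 0 δ₀) : HasBoundedMoments V (μ δ) := fun k T => by
  obtain ⟨C, hC⟩ := h.moments k T
  exact ⟨C, hC δ hδ⟩

theorem integrable (h : LinearResponseSetting M V F σ κ ρ F' σ' G H δ₀ μ)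
    (hδ : δ ∈ Ioc 0 δ₀) (ht : 0 ≤ t) (hf : IsTempered M V f) : Integrable f (μ δ t) :=
  hf.integrable h.isOpen h.weight.one_le ((h.solution δ hδ).mem t ht)
    ((h.hasBoundedMoments hδ).integrable ht)

theorem opGenerator (h : LinearResponseSetting M V F σ κ ρ F' σ' G H δ₀ μ) :
    IsTemperedOp M V (generator F σ) :=
  isTemperedOp_generator h.isOpen h.weight.one_le h.drift h.diffusion

theorem opDrift (h : LinearResponseSetting M V F σ κ ρ F' σ' G H δ₀ μ) (i : Fin d) :
    IsTemperedOp M V (driftOp F' i) :=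
  isTemperedOp_driftOp h.isOpen h.weight.one_le h.drift' i

theorem opDiffusion (h : LinearResponseSetting M V F σ κ ρ F' σ' G H δ₀ μ) (i : Fin d) :
    IsTemperedOp M V (diffusionOp σ' i) :=
  isTemperedOp_diffusionOp h.isOpen h.weight.one_le h.diffusion' i

theorem integrable_size (h : LinearResponseSetting M V F σ κ ρ F' σ' G H δ₀ μ) (ht : 0 ≤ t) :
    IntervalIntegrable (perturbationSize G H) volume 0 t :=
  intervalIntegrable_perturbationSize (fun i => h.integrable_drift i t ht)
    fun i => h.integrable_diffusion i t ht

theorem exists_abs_integral_le (h : LinearResponseSetting M V F σ κ ρ F' σ' G H δ₀ μ)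
    (hS : IsTemperedFamily M V S) (T : ℝ) :
    ∃ C : ℝ, 0 ≤ C ∧ ∀ f ∈ S, ∀ δ ∈ Ioc 0 δ₀, ∀ t ∈ Icc 0 T, |∫ x, f x ∂(μ δ t)| ≤ C := by
  obtain ⟨k, C, hC, hb⟩ := hS.exists_abs_le h.weight.one_le
  obtain ⟨B, hB⟩ := h.moments k T
  refine ⟨C * |B|, by positivity, fun f hf δ hδ t ht => ?_⟩
  refine (abs_integral_le_of_abs_le ((h.solution δ hδ).mem t ht.1)
    ((hB δ hδ t ht).1.const_mul C) (hb f hf)).trans ?_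
  rw [integral_const_mul]
  exact mul_le_mul_of_nonneg_left ((hB δ hδ t ht).2.trans (le_abs_self _)) hC

theorem exists_abs_integral_ops_le (h : LinearResponseSetting M V F σ κ ρ F' σ' G H δ₀ μ)
    (hS : IsTemperedFamily M V S) (T : ℝ) :
    ∃ C : ℝ, 0 ≤ C ∧ ∀ i, ∀ f ∈ S, ∀ δ ∈ Ioc 0 δ₀, ∀ t ∈ Icc 0 T,
      |∫ x, driftOp F' i f x ∂(μ δ t)| ≤ C ∧ |∫ x, diffusionOp σ' i f x ∂(μ δ t)| ≤ C := by
  refine exists_common_bound (fun i C C' hCC hP f hf δ hδ t ht =>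
    ⟨(hP f hf δ hδ t ht).1.trans hCC, (hP f hf δ hδ t ht).2.trans hCC⟩) fun i => ?_
  obtain ⟨C, hC, hb⟩ := h.exists_abs_integral_le ((h.opDrift i).image S hS) T
  obtain ⟨B, hB, hc⟩ := h.exists_abs_integral_le ((h.opDiffusion i).image S hS) T
  refine ⟨C + B, by positivity, fun f hf δ hδ t ht => ⟨?_, ?_⟩⟩
  · exact (hb _ (mem_image_of_mem _ hf) δ hδ t ht).trans (by linarith)
  · exact (hc _ (mem_image_of_mem _ hf) δ hδ t ht).trans (by linarith)

/-- The averages over the perturbed system are absolutely continuous in time, uniformly on bounded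
families of observables. -/
theorem exists_abs_integral_sub_le (h : LinearResponseSetting M V F σ κ ρ F' σ' G H δ₀ μ)
    (hS : IsTemperedFamily M V S) (T : ℝ) :
    ∃ C : ℝ, 0 ≤ C ∧ ∀ f ∈ S, ∀ δ ∈ Ioc 0 δ₀, ∀ s t, 0 ≤ s → s ≤ t → t ≤ T →
      |∫ x, f x ∂(μ δ t) - ∫ x, f x ∂(μ δ s)| ≤ C * ∫ r in s..t, perturbationSize G H r := by
  obtain ⟨C, hC, hb⟩ := h.exists_abs_integral_le (h.opGenerator.image S hS) T
  obtain ⟨B, hB, hc⟩ := h.exists_abs_integral_ops_le hS T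
  -- `C` bounds the averages of `K f` and `B` those of the perturbing operators; `δ ≤ δ₀` makes the
  -- sum independent of `δ`.
  refine ⟨C + |δ₀| * B, by positivity, fun f hf δ hδ s t hs hst ht => ?_⟩
  rw [((h.solution δ hδ).integral_sub_integral_of_tempered h.isOpen h.weight h.drift h.diffusion
    h.drift' h.diffusion' h.integrable_drift h.integrable_diffusion (h.hasBoundedMoments hδ)
    (hS.isTempered hf) hs (hs.trans hst)).2, ← intervalIntegral.integral_const_mul]
  refine intervalIntegral.norm_integral_le_of_norm_le
    (f := fun r => forwardRate F σ F' σ' G H δ (μ δ r) f r) hst (ae_of_all _ fun r hr => ?_)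
    (((h.integrable_size (hs.trans hst)).mono_Icc hs hst le_rfl).const_mul _)
  have hr' : r ∈ Icc 0 T := ⟨hs.trans hr.1.le, hr.2.trans ht⟩
  have h1 := hb _ (mem_image_of_mem _ hf) δ hδ r hr'
  have h2 := abs_sum_le_perturbationSize (G := G) (H := H) hB
    (fun i => (hc i f hf δ hδ r hr').1) (fun i => (hc i f hf δ hδ r hr').2) r
  have h3 : |δ| ≤ |δ₀| := by
    rw [abs_of_pos hδ.1]; exact hδ.2.trans (le_abs_self _)
  have h4 := one_le_perturbationSize (G := G) (H := H) r
  rw [Real.norm_eq_abs, forwardRate, add_mul, mul_assoc]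
  refine (abs_add_le _ _).trans (add_le_add (h1.trans (le_mul_of_one_le_right hC h4)) ?_)
  rw [abs_mul]
  exact mul_le_mul h3 h2 (abs_nonneg _) (abs_nonneg _)

theorem continuousOn_integral (h : LinearResponseSetting M V F σ κ ρ F' σ' G H δ₀ μ)
    (hδ : δ ∈ Ioc 0 δ₀) (hf : IsTempered M V f) (T : ℝ) :
    ContinuousOn (fun t => ∫ x, f x ∂(μ δ t)) (Icc 0 T) :=
  (h.solution δ hδ).continuousOn_integral h.isOpen h.weight (h.hasBoundedMoments hδ) hf T

theorem intervalIntegrable_ops (h : LinearResponseSetting M V F σ κ ρ F' σ' G H δ₀ μ)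
    (hδ : δ ∈ Ioc 0 δ₀) (hf : IsTempered M V f) {s t : ℝ} (hs : 0 ≤ s) (hst : s ≤ t) :
    IntervalIntegrable (fun r => ∑ i, (G i r * ∫ x, driftOp F' i f x ∂(μ δ r)
      + H i r ^ 2 * ∫ x, diffusionOp σ' i f x ∂(μ δ r))) volume s t := by
  have ht := hs.trans hst
  have e := uIcc_of_le ht
  refine IntervalIntegrable.mono_Icc (a := 0) (b := t)
    (intervalIntegrable_fun_sum _ fun i _ => ?_) hs hst le_rfl
  refine ((h.integrable_drift i t ht).mul_continuousOn ?_).add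
    ((h.integrable_diffusion i t ht).mul_continuousOn ?_)
  · rw [e]; exact h.continuousOn_integral hδ ((h.opDrift i).tempered hf) t
  · rw [e]; exact h.continuousOn_integral hδ ((h.opDiffusion i).tempered hf) t

/-- Duhamel's formula on a short time interval. -/
theorem exists_duhamel_local (h : LinearResponseSetting M V F σ κ ρ F' σ' G H δ₀ μ)
    (hS : IsTemperedFamily M V S) (T : ℝ) :
    ∃ C : ℝ, 0 ≤ C ∧ ∀ u ∈ S, ∀ δ ∈ Ioc 0 δ₀, ∀ t ∈ Icc 0 T, ∀ s s', 0 ≤ s → s ≤ s' → s' ≤ t →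
      |∫ x, semigroup κ (t - s') u x ∂(μ δ s') - ∫ x, semigroup κ (t - s) u x ∂(μ δ s)
        - δ * ∫ r in s..s', ∑ i, (G i r * ∫ x, driftOp F' i (semigroup κ (t - s') u) x ∂(μ δ r)
          + H i r ^ 2 * ∫ x, diffusionOp σ' i (semigroup κ (t - s') u) x ∂(μ δ r))|
        ≤ C * (s' - s) * ∫ r in s..s', perturbationSize G H r := by
  have hP := h.acts.bounded S hS T
  obtain ⟨C, hC, hb⟩ := h.exists_abs_integral_sub_le (h.opGenerator.image _ hP) T
  obtain ⟨k, B, hB, hc⟩ := h.transition.exists_abs_semigroup_sub_sub_le h.isOpen h.weight h.drift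
    h.diffusion h.acts hP T
  obtain ⟨D, hD⟩ := h.moments k T
  refine ⟨C + B * |D|, by positivity, fun u hu δ hδ t ht s s' hs hss hst => ?_⟩
  have hs' := hs.trans hss
  have hut := hS.isTempered hu
  -- The observable is frozen at the right endpoint: `P_{t-s} u = P_{s'-s} w`, so the semigroup is
  -- expanded against `μ_s` while `μ` moves against the fixed `w`.
  set w := semigroup κ (t - s') u with hw
  have hwP : w ∈ {g | ∃ f ∈ S, ∃ t ∈ Icc 0 T, g = semigroup κ t f} :=
    ⟨u, hu, t - s', ⟨by linarith, by linarith [ht.2]⟩, rfl⟩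
  have hwt : IsTempered M V w := hP.isTempered hwP
  have hgt : IsTempered M V (generator F σ w) := h.opGenerator.tempered hwt
  have hmem := (h.solution δ hδ).mem s hs
  have hPw : ∫ x, semigroup κ (t - s) u x ∂(μ δ s) = ∫ x, semigroup κ (s' - s) w x ∂(μ δ s) := by
    refine integral_congr_ae ?_
    filter_upwards [mem_ae_iff.2 hmem] with x hx
    rw [hw, ← h.transition.semigroup_add h.acts hut (by linarith) (by linarith) hx]
    congr 1; ring
  have hpt : IsTempered M V (semigroup κ (s' - s) w) :=
    h.acts.isTempered_semigroup hwt (by linarith)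
  have hrate := ((h.solution δ hδ).integral_sub_integral_of_tempered h.isOpen h.weight h.drift
    h.diffusion h.drift' h.diffusion' h.integrable_drift h.integrable_diffusion
    (h.hasBoundedMoments hδ) hwt hs hs').2
  have hgi : IntervalIntegrable (fun r => ∫ x, generator F σ w x ∂(μ δ r)) volume s s' :=
    ((h.continuousOn_integral hδ hgt s').mono (by
      rw [uIcc_of_le hss]; exact Icc_subset_Icc_left hs)).intervalIntegrable
  simp only [forwardRate] at hrate
  rw [intervalIntegral.integral_add hgi ((h.intervalIntegrable_ops hδ hwt hs hss).const_mul δ),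
    intervalIntegral.integral_const_mul] at hrate
  have hconst : (s' - s) * ∫ x, generator F σ w x ∂(μ δ s)
      = ∫ _ in s..s', ∫ x, generator F σ w x ∂(μ δ s) := by simp
  have hquad : ∫ x, (semigroup κ (s' - s) w x - w x - (s' - s) * generator F σ w x) ∂(μ δ s)
      = ∫ x, semigroup κ (s' - s) w x ∂(μ δ s) - ∫ x, w x ∂(μ δ s)
        - ∫ _ in s..s', ∫ x, generator F σ w x ∂(μ δ s) := by
    have hsub : Integrable (fun x => semigroup κ (s' - s) w x - w x) (μ δ s) :=
      (h.integrable hδ hs hpt).sub (h.integrable hδ hs hwt)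
    rw [← hconst, integral_sub hsub ((h.integrable hδ hs hgt).const_mul _),
      integral_sub (h.integrable hδ hs hpt) (h.integrable hδ hs hwt), integral_const_mul]
  have hlin := intervalIntegral.integral_sub hgi
    (intervalIntegrable_const (c := ∫ x, generator F σ w x ∂(μ δ s)))
  have hsize := (h.integrable_size hs').mono_Icc hs hss le_rfl
  -- First error: the average of `K w` drifts by at most `C ∫ m` within the interval, and
  -- integrating this in time contributes the factor `s' - s`.
  have hE1 : |∫ r in s..s', (∫ x, generator F σ w x ∂(μ δ r) - ∫ x, generator F σ w x ∂(μ δ s))|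
      ≤ C * (s' - s) * ∫ r in s..s', perturbationSize G H r := by
    have := intervalIntegral.norm_integral_le_of_norm_le_const (a := s) (b := s')
      (f := fun r => ∫ x, generator F σ w x ∂(μ δ r) - ∫ x, generator F σ w x ∂(μ δ s))
      (C := C * ∫ r in s..s', perturbationSize G H r) (fun r hr => by
        rw [uIoc_of_le hss] at hr
        refine (hb _ (mem_image_of_mem _ hwP) δ hδ s r hs hr.1.le
          (hr.2.trans (hst.trans ht.2))).trans (mul_le_mul_of_nonneg_left ?_ hC)
        exact integral_perturbationSize_mono le_rfl hr.1.le hr.2 hsize)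
    rw [abs_of_nonneg (sub_nonneg.2 hss)] at this
    exact this.trans_eq (by ring)
  -- Second error: the Taylor remainder is of order `(s' - s)²`, and one factor is dominated by `∫
  -- m` to match the first error.
  have hE2 : |∫ x, (semigroup κ (s' - s) w x - w x - (s' - s) * generator F σ w x) ∂(μ δ s)|
      ≤ B * |D| * (s' - s) * ∫ r in s..s', perturbationSize G H r := by
    have hsT : s ∈ Icc 0 T := ⟨hs, hss.trans (hst.trans ht.2)⟩
    refine (abs_integral_le_of_abs_le hmem ((hD δ hδ s hsT).1.const_mul (B * (s' - s) ^ 2))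
      (hc w hwP (s' - s) ⟨by linarith, by linarith [ht.2]⟩)).trans ?_
    rw [integral_const_mul]
    have h1 := sub_le_integral_perturbationSize hss hsize
    have h2 : 0 ≤ s' - s := sub_nonneg.2 hss
    calc B * (s' - s) ^ 2 * ∫ x, V x ^ k ∂(μ δ s) ≤ B * (s' - s) ^ 2 * |D| := by
          gcongr; exact (hD δ hδ s hsT).2.trans (le_abs_self _)
      _ = B * |D| * (s' - s) * (s' - s) := by ring
      _ ≤ _ := by gcongr
  rw [hPw]
  have key : ∫ x, w x ∂(μ δ s') - ∫ x, semigroup κ (s' - s) w x ∂(μ δ s)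
      - δ * ∫ r in s..s', ∑ i, (G i r * ∫ x, driftOp F' i w x ∂(μ δ r)
          + H i r ^ 2 * ∫ x, diffusionOp σ' i w x ∂(μ δ r))
      = (∫ r in s..s', (∫ x, generator F σ w x ∂(μ δ r) - ∫ x, generator F σ w x ∂(μ δ s)))
        - ∫ x, (semigroup κ (s' - s) w x - w x - (s' - s) * generator F σ w x) ∂(μ δ s) := by
    rw [hquad, hlin]; linarith
  rw [key]
  refine (abs_sub _ _).trans ((add_le_add hE1 hE2).trans_eq (by ring))

theorem semigroup_zero (h : LinearResponseSetting M V F σ κ ρ F' σ' G H δ₀ μ)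
    (f : State d → ℝ) {x : State d} (hx : x ∈ M) : semigroup κ 0 f x = f x := by
  rw [semigroup, (h.transition.forward x hx).initial, integral_dirac]

theorem integral_semigroup_zero (h : LinearResponseSetting M V F σ κ ρ F' σ' G H δ₀ μ)
    (hδ : δ ∈ Ioc 0 δ₀) (ht : 0 ≤ t) (f : State d → ℝ) :
    ∫ x, semigroup κ 0 f x ∂(μ δ t) = ∫ x, f x ∂(μ δ t) := by
  refine integral_congr_ae ?_
  filter_upwards [mem_ae_iff.2 ((h.solution δ hδ).mem t ht)] with x hx using h.semigroup_zero f hx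

theorem integral_initial (h : LinearResponseSetting M V F σ κ ρ F' σ' G H δ₀ μ)
    (hδ : δ ∈ Ioc 0 δ₀) (f : State d → ℝ) : ∫ x, f x ∂(μ δ 0) = steadyAverage M ρ f := by
  rw [(h.solution δ hδ).initial, integral_densityMeasure h.isOpen h.steady.smooth.continuousOn
    h.steady.pos]

theorem integrable_steady (h : LinearResponseSetting M V F σ κ ρ F' σ' G H δ₀ μ)
    (hf : IsTempered M V f) : Integrable f (densityMeasure M ρ) :=
  hf.integrable h.isOpen h.weight.one_le (densityMeasure_compl h.isOpen ρ)
    (h.decay.integrable_pow h.isOpen h.steady.smooth.continuousOn h.steady.pos)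

theorem steadyAverage_semigroup (h : LinearResponseSetting M V F σ κ ρ F' σ' G H δ₀ μ)
    (hf : IsTempered M V f) (ht : 0 ≤ t) :
    steadyAverage M ρ (semigroup κ t f) = steadyAverage M ρ f := by
  have hc := h.steady.smooth.continuousOn
  rw [← integral_densityMeasure h.isOpen hc h.steady.pos,
    ← integral_densityMeasure h.isOpen hc h.steady.pos]
  exact integral_semigroup_of_invariant (h.steady.invariant t ht) (h.integrable_steady hf)

/-- The perturbation changes averages by `O(δ)`, uniformly on bounded families of observables. -/
theorem exists_abs_integral_sub_steadyAverage_le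
    (h : LinearResponseSetting M V F σ κ ρ F' σ' G H δ₀ μ)
    (hS : IsTemperedFamily M V S) (T : ℝ) :
    ∃ C : ℝ, 0 ≤ C ∧ ∀ u ∈ S, ∀ δ ∈ Ioc 0 δ₀, ∀ t ∈ Icc 0 T,
      |∫ x, u x ∂(μ δ t) - steadyAverage M ρ u| ≤ C * δ := by
  obtain ⟨C, hC, hb⟩ := h.exists_duhamel_local hS T
  obtain ⟨B, hB, hc⟩ := h.exists_abs_integral_ops_le (h.acts.bounded S hS T) T
  refine ⟨B * |∫ r in (0 : ℝ)..T, perturbationSize G H r|, by positivity,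
    fun u hu δ hδ t ht => ?_⟩
  have hT := ht.1.trans ht.2
  -- `Ψ` runs from `⟨P_t u⟩ = ⟨u⟩` to `∫ u dμ_t`. The perturbing term in each increment is only
  -- bounded here, which gives one power of `δ`.
  have key := abs_sub_le_of_local_increment_le
    (Ψ := fun s => ∫ x, semigroup κ (t - s) u x ∂(μ δ s)) (a := δ * B) (c := C) ht.1
    (h.integrable_size ht.1) fun s s' hs hss hst => by
      have h1 := hb u hu δ hδ t ht s s' hs hss hst
      have h2 : |δ * ∫ r in s..s', ∑ i,
          (G i r * ∫ x, driftOp F' i (semigroup κ (t - s') u) x ∂(μ δ r)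
          + H i r ^ 2 * ∫ x, diffusionOp σ' i (semigroup κ (t - s') u) x ∂(μ δ r))|
          ≤ δ * B * ∫ r in s..s', perturbationSize G H r := by
        rw [abs_mul, abs_of_pos hδ.1, mul_assoc]
        refine mul_le_mul_of_nonneg_left ?_ hδ.1.le
        rw [← intervalIntegral.integral_const_mul]
        refine intervalIntegral.norm_integral_le_of_norm_le (f := fun r => ∑ i,
          (G i r * ∫ x, driftOp F' i (semigroup κ (t - s') u) x ∂(μ δ r)
          + H i r ^ 2 * ∫ x, diffusionOp σ' i (semigroup κ (t - s') u) x ∂(μ δ r))) hss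
          (ae_of_all _ fun r hr => ?_)
          (((h.integrable_size ht.1).mono_Icc hs hss hst).const_mul _)
        have hw : semigroup κ (t - s') u ∈ {g | ∃ f ∈ S, ∃ t ∈ Icc 0 T, g = semigroup κ t f} :=
          ⟨u, hu, t - s', ⟨by linarith, by linarith [ht.2]⟩, rfl⟩
        have hr' : r ∈ Icc 0 T := ⟨hs.trans hr.1.le, hr.2.trans (hst.trans ht.2)⟩
        exact abs_sum_le_perturbationSize hB (fun i => (hc i _ hw δ hδ r hr').1)
          (fun i => (hc i _ hw δ hδ r hr').2) r
      have h3 := abs_sub_abs_le_abs_sub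
        (∫ x, semigroup κ (t - s') u x ∂(μ δ s') - ∫ x, semigroup κ (t - s) u x ∂(μ δ s))
        (δ * ∫ r in s..s', ∑ i,
          (G i r * ∫ x, driftOp F' i (semigroup κ (t - s') u) x ∂(μ δ r)
          + H i r ^ 2 * ∫ x, diffusionOp σ' i (semigroup κ (t - s') u) x ∂(μ δ r)))
      linarith
  simp only [sub_self, sub_zero] at key
  rw [h.integral_semigroup_zero hδ ht.1, h.integral_initial hδ,
    h.steadyAverage_semigroup (hS.isTempered hu) ht.1] at key
  refine key.trans ?_
  have h1 := (integral_perturbationSize_mono le_rfl ht.1 ht.2 (h.integrable_size hT)).trans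
    (le_abs_self _)
  have := hδ.1.le
  calc δ * B * ∫ r in (0 : ℝ)..t, perturbationSize G H r
      ≤ δ * B * |∫ r in (0 : ℝ)..T, perturbationSize G H r| := by gcongr
    _ = _ := by ring

end LinearResponseSetting

/-! ### The linear response formula with quadratic error -/

namespace LinearResponseSetting

variable {d : ℕ} {M : Set (State d)} {V : State d → ℝ} {F σ : Fin d → State d → ℝ}
  {κ : ℝ → Kernel (State d) (State d)} {ρ : State d → ℝ} {F' σ' : Fin d → State d → ℝ}
  {G H : Fin d → ℝ → ℝ} {δ₀ : ℝ} {μ : ℝ → ℝ → Measure (State d)} {S : Set (State d → ℝ)}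
  {δ t : ℝ} {f u r : State d → ℝ}

theorem rapid_driftResponse (h : LinearResponseSetting M V F σ κ ρ F' σ' G H δ₀ μ) (i : Fin d) :
    IsRapidlyIntegrable M V fun x => driftResponse ρ F' i x * ρ x :=
  isRapidlyIntegrable_driftResponse h.isOpen h.weight h.steady.smooth h.steady.pos h.decay
    (h.drift' i)

theorem rapid_noiseResponse (h : LinearResponseSetting M V F σ κ ρ F' σ' G H δ₀ μ) (i : Fin d) :
    IsRapidlyIntegrable M V fun x => noiseResponse ρ σ' i x * ρ x :=
  isRapidlyIntegrable_noiseResponse h.isOpen h.weight h.steady.smooth h.steady.pos h.decay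
    (h.diffusion' i)

theorem integrableOn_response (h : LinearResponseSetting M V F σ κ ρ F' σ' G H δ₀ μ)
    (hr : IsRapidlyIntegrable M V fun x => r x * ρ x) (hu : IsTempered M V u) (ht : 0 ≤ t) :
    IntegrableOn (fun x => r x * semigroup κ t u x * ρ x) M :=
  ((hr.mul h.isOpen h.weight (h.acts.isTempered_semigroup hu ht)).integrableOn
    h.isOpen).congr_fun (fun _ _ => by ring) h.isOpen.measurableSet

theorem intervalIntegrable_response (h : LinearResponseSetting M V F σ κ ρ F' σ' G H δ₀ μ)
    (hr : IsRapidlyIntegrable M V fun x => r x * ρ x) (hu : IsTempered M V u) (ht : 0 ≤ t)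
    {g : ℝ → ℝ} (hg : IntervalIntegrable g volume 0 t) :
    IntervalIntegrable
      (fun s => steadyAverage M ρ (fun x => r x * semigroup κ (t - s) u x) * g s) volume 0 t :=
  hg.continuousOn_mul (by
    rw [uIcc_of_le ht]
    exact continuousOn_response h.isOpen h.weight h.drift h.diffusion h.transition h.acts hr hu t)

theorem intervalIntegrable_response_sum (h : LinearResponseSetting M V F σ κ ρ F' σ' G H δ₀ μ)
    (hu : IsTempered M V u) (ht : 0 ≤ t) :
    IntervalIntegrable (fun s => ∑ i,
      (G i s * -steadyAverage M ρ (fun x => driftResponse ρ F' i x * semigroup κ (t - s) u x)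
        + H i s ^ 2
          * steadyAverage M ρ (fun x => noiseResponse ρ σ' i x * semigroup κ (t - s) u x)))
      volume 0 t := by
  refine intervalIntegrable_fun_sum _ fun i _ => ?_
  have h1 := h.intervalIntegrable_response (h.rapid_driftResponse i) hu ht
    (h.integrable_drift i t ht)
  have h2 := h.intervalIntegrable_response (h.rapid_noiseResponse i) hu ht
    (h.integrable_diffusion i t ht)
  convert h1.neg.add h2 using 1
  ext s; simp only [Pi.neg_apply]; ring

/-- The first-order bound is applied to the images of a bounded family under the perturbing
operators. Together with the prefactor `δ` of the perturbation it yields `δ²`. -/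
theorem exists_abs_integral_ops_sub_le (h : LinearResponseSetting M V F σ κ ρ F' σ' G H δ₀ μ)
    (hS : IsTemperedFamily M V S) (T : ℝ) :
    ∃ C : ℝ, 0 ≤ C ∧ ∀ i, ∀ f ∈ S, ∀ δ ∈ Ioc 0 δ₀, ∀ t ∈ Icc 0 T,
      |∫ x, driftOp F' i f x ∂(μ δ t) - steadyAverage M ρ (driftOp F' i f)| ≤ C * δ ∧
      |∫ x, diffusionOp σ' i f x ∂(μ δ t) - steadyAverage M ρ (diffusionOp σ' i f)| ≤ C * δ := by
  refine exists_common_bound (fun i C C' hCC hP f hf δ hδ t ht =>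
    ⟨(hP f hf δ hδ t ht).1.trans (mul_le_mul_of_nonneg_right hCC hδ.1.le),
      (hP f hf δ hδ t ht).2.trans (mul_le_mul_of_nonneg_right hCC hδ.1.le)⟩) fun i => ?_
  obtain ⟨C, hC, hb⟩ :=
    h.exists_abs_integral_sub_steadyAverage_le ((h.opDrift i).image S hS) T
  obtain ⟨B, hB, hc⟩ :=
    h.exists_abs_integral_sub_steadyAverage_le ((h.opDiffusion i).image S hS) T
  refine ⟨C + B, by positivity, fun f hf δ hδ t ht => ⟨?_, ?_⟩⟩
  · exact (hb _ (mem_image_of_mem _ hf) δ hδ t ht).trans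
      (mul_le_mul_of_nonneg_right (by linarith) hδ.1.le)
  · exact (hc _ (mem_image_of_mem _ hf) δ hδ t ht).trans
      (mul_le_mul_of_nonneg_right (by linarith) hδ.1.le)

theorem exists_abs_responses_sub_le (h : LinearResponseSetting M V F σ κ ρ F' σ' G H δ₀ μ)
    (hS : IsTemperedFamily M V S) (T : ℝ) :
    ∃ C : ℝ, 0 ≤ C ∧ ∀ i, ∀ u ∈ S, ∀ p q, 0 ≤ p → p ≤ q → q ≤ T →
      |steadyAverage M ρ (fun x => driftResponse ρ F' i x * semigroup κ q u x)
        - steadyAverage M ρ (fun x => driftResponse ρ F' i x * semigroup κ p u x)|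
        ≤ C * (q - p) ∧
      |steadyAverage M ρ (fun x => noiseResponse ρ σ' i x * semigroup κ q u x)
        - steadyAverage M ρ (fun x => noiseResponse ρ σ' i x * semigroup κ p u x)|
        ≤ C * (q - p) := by
  refine exists_common_bound (fun i C C' hCC hP u hu p q hp hpq hq =>
    ⟨(hP u hu p q hp hpq hq).1.trans (mul_le_mul_of_nonneg_right hCC (by linarith)),
      (hP u hu p q hp hpq hq).2.trans (mul_le_mul_of_nonneg_right hCC (by linarith))⟩)
    fun i => ?_
  obtain ⟨C, hC, hb⟩ := exists_abs_response_sub_le h.isOpen h.weight h.drift h.diffusion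
    h.transition h.acts (h.rapid_driftResponse i) hS T
  obtain ⟨B, hB, hc⟩ := exists_abs_response_sub_le h.isOpen h.weight h.drift h.diffusion
    h.transition h.acts (h.rapid_noiseResponse i) hS T
  refine ⟨C + B, by positivity, fun u hu p q hp hpq hq => ⟨?_, ?_⟩⟩
  · exact (hb u hu p q hp hpq hq).trans (mul_le_mul_of_nonneg_right (by linarith) (by linarith))
  · exact (hc u hu p q hp hpq hq).trans (mul_le_mul_of_nonneg_right (by linarith) (by linarith))

/-- Linear response, with all contributions under one time integral. -/
theorem exists_linear_response (h : LinearResponseSetting M V F σ κ ρ F' σ' G H δ₀ μ)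
    (hu : IsTempered M V u) (T : ℝ) :
    ∃ C : ℝ, ∀ δ ∈ Ioc 0 δ₀, ∀ t ∈ Icc 0 T,
      |∫ x, u x ∂(μ δ t) - steadyAverage M ρ (semigroup κ t u)
        - δ * ∫ s in (0 : ℝ)..t, ∑ i,
          (G i s * -steadyAverage M ρ (fun x => driftResponse ρ F' i x * semigroup κ (t - s) u x)
            + H i s ^ 2
              * steadyAverage M ρ (fun x => noiseResponse ρ σ' i x * semigroup κ (t - s) u x))|
        ≤ C * δ ^ 2 := by
  obtain ⟨C, hC, hb⟩ := h.exists_duhamel_local hu T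
  obtain ⟨B, hB, hc⟩ := h.exists_abs_integral_ops_sub_le (h.acts.bounded _ hu T) T
  obtain ⟨L, hL, hl⟩ := h.exists_abs_responses_sub_le hu T
  refine ⟨B * |∫ r in (0 : ℝ)..T, perturbationSize G H r|, fun δ hδ t ht => ?_⟩
  have hT := ht.1.trans ht.2
  have hδ' := hδ.1.le
  have hδδ : δ ≤ |δ₀| := hδ.2.trans (le_abs_self _)
  set R : ℝ → ℝ := fun s => ∑ i,
    (G i s * -steadyAverage M ρ (fun x => driftResponse ρ F' i x * semigroup κ (t - s) u x)
      + H i s ^ 2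
        * steadyAverage M ρ (fun x => noiseResponse ρ σ' i x * semigroup κ (t - s) u x)) with hR
  have hRi : IntervalIntegrable R volume 0 t := h.intervalIntegrable_response_sum hu ht.1
  -- The predicted response up to time `s` is subtracted from the Duhamel interpolation. What
  -- survives refinement is `B δ²`; the local errors in `c` come from Duhamel (`C`) and from
  -- freezing the semigroup time (`L`).
  have key := abs_sub_le_of_local_increment_le
    (Ψ := fun s => ∫ x, semigroup κ (t - s) u x ∂(μ δ s) - δ * ∫ r in (0 : ℝ)..s, R r)
    (a := B * δ ^ 2) (c := C + |δ₀| * L) ht.1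
    (h.integrable_size ht.1) fun s s' hs hss hst => by
      have hw : semigroup κ (t - s') u ∈
          {g | ∃ f ∈ ({u} : Set (State d → ℝ)), ∃ t ∈ Icc 0 T, g = semigroup κ t f} :=
        ⟨u, rfl, t - s', ⟨by linarith, by linarith [ht.2]⟩, rfl⟩
      have hwt := (h.acts.bounded _ hu T).isTempered hw
      have h1 := hb u rfl δ hδ t ht s s' hs hss hst
      have hsize := (h.integrable_size ht.1).mono_Icc hs hss hst
      set Q : ℝ → ℝ := fun r => ∑ i,
          (G i r * ∫ x, driftOp F' i (semigroup κ (t - s') u) x ∂(μ δ r)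
          + H i r ^ 2 * ∫ x, diffusionOp σ' i (semigroup κ (t - s') u) x ∂(μ δ r)) with hQ
      have hQi : IntervalIntegrable Q volume s s' := h.intervalIntegrable_ops hδ hwt hs hss
      -- Two replacements separate `Q` from `R`: `μ_r` by the steady state costs `B δ`, and the time
      -- `t - s'` by `t - r` in the response functions costs at most `L (s' - s)`.
      have h2 : |∫ r in s..s', (Q r - R r)|
          ≤ (B * δ + L * (s' - s)) * ∫ r in s..s', perturbationSize G H r := by
        rw [← intervalIntegral.integral_const_mul]
        refine intervalIntegral.norm_integral_le_of_norm_le (f := fun r => Q r - R r) hss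
          (ae_of_all _ fun r hr => ?_) (hsize.const_mul _)
        have hr' : r ∈ Icc 0 T := ⟨hs.trans hr.1.le, hr.2.trans (hst.trans ht.2)⟩
        have hLr : L * (t - r - (t - s')) ≤ L * (s' - s) :=
          mul_le_mul_of_nonneg_left (by linarith [hr.1]) hL
        have e : Q r - R r = ∑ i, (G i r *
            (∫ x, driftOp F' i (semigroup κ (t - s') u) x ∂(μ δ r)
              + steadyAverage M ρ (fun x => driftResponse ρ F' i x * semigroup κ (t - r) u x))
          + H i r ^ 2 * (∫ x, diffusionOp σ' i (semigroup κ (t - s') u) x ∂(μ δ r)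
              - steadyAverage M ρ
                (fun x => noiseResponse ρ σ' i x * semigroup κ (t - r) u x))) := by
          simp only [hQ, hR, ← Finset.sum_sub_distrib]
          exact Finset.sum_congr rfl fun i _ => by ring
        rw [Real.norm_eq_abs, e]
        refine abs_sum_le_perturbationSize
          (add_nonneg (by positivity) (mul_nonneg hL (sub_nonneg.2 hss)))
          (fun i => ?_) (fun i => ?_) r
        · have g1 := (hc i _ hw δ hδ r hr').1
          have g2 := (hl i u rfl (t - s') (t - r) (by linarith) (by linarith [hr.2])
            (by linarith [hr'.1, ht.2])).1
          -- Integration by parts enters here, at the frozen time `t - s'`. Afterwards only the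
          -- response function is compared at two times, so no continuity in time of derivatives of
          -- `P_τ u` is needed.
          rw [steadyAverage_driftOp h.isOpen h.weight h.steady.smooth h.steady.pos h.decay
            (h.drift' i) hwt] at g1
          rw [abs_le] at g1 g2 ⊢
          constructor <;> linarith [g1.1, g1.2, g2.1, g2.2]
        · have g1 := (hc i _ hw δ hδ r hr').2
          have g2 := (hl i u rfl (t - s') (t - r) (by linarith) (by linarith [hr.2])
            (by linarith [hr'.1, ht.2])).2
          rw [steadyAverage_diffusionOp h.isOpen h.weight h.steady.smooth h.steady.pos h.decay
            (h.diffusion' i) hwt] at g1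
          rw [abs_le] at g1 g2 ⊢
          constructor <;> linarith [g1.1, g1.2, g2.1, g2.2]
      have h3 : ∫ r in s..s', (Q r - R r)
          = (∫ r in s..s', Q r) - ((∫ r in (0 : ℝ)..s', R r) - ∫ r in (0 : ℝ)..s, R r) := by
        rw [intervalIntegral.integral_sub hQi (hRi.mono_Icc hs hss hst),
          intervalIntegral.integral_interval_sub_left
            (hRi.mono_Icc le_rfl (hs.trans hss) hst) (hRi.mono_Icc le_rfl hs (hss.trans hst))]
      have e : (∫ x, semigroup κ (t - s') u x ∂(μ δ s') - δ * ∫ r in (0 : ℝ)..s', R r)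
          - (∫ x, semigroup κ (t - s) u x ∂(μ δ s) - δ * ∫ r in (0 : ℝ)..s, R r)
          = (∫ x, semigroup κ (t - s') u x ∂(μ δ s') - ∫ x, semigroup κ (t - s) u x ∂(μ δ s)
            - δ * ∫ r in s..s', Q r) + δ * ∫ r in s..s', (Q r - R r) := by
        rw [h3]; ring
      have hm0 : 0 ≤ ∫ r in s..s', perturbationSize G H r :=
        (sub_nonneg.2 hss).trans (sub_le_integral_perturbationSize hss hsize)
      have h0 : 0 ≤ s' - s := sub_nonneg.2 hss
      rw [e]
      refine (abs_add_le _ _).trans ((add_le_add h1 ?_).trans_eq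
        (b := C * (s' - s) * (∫ r in s..s', perturbationSize G H r)
          + (B * δ ^ 2 + |δ₀| * L * (s' - s)) * ∫ r in s..s', perturbationSize G H r) (by ring))
      rw [abs_mul, abs_of_nonneg hδ']
      calc δ * |∫ r in s..s', (Q r - R r)|
          ≤ δ * ((B * δ + L * (s' - s)) * ∫ r in s..s', perturbationSize G H r) := by gcongr
        _ = (B * δ ^ 2 + δ * L * (s' - s)) * ∫ r in s..s', perturbationSize G H r := by ring
        _ ≤ _ := by gcongr
  simp only [sub_self, sub_zero, intervalIntegral.integral_same, mul_zero] at key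
  rw [h.integral_semigroup_zero hδ ht.1, h.integral_initial hδ, sub_right_comm] at key
  refine key.trans ?_
  have h1 := (integral_perturbationSize_mono le_rfl ht.1 ht.2 (h.integrable_size hT)).trans
    (le_abs_self _)
  calc B * δ ^ 2 * ∫ r in (0 : ℝ)..t, perturbationSize G H r
      ≤ B * δ ^ 2 * |∫ r in (0 : ℝ)..T, perturbationSize G H r| := by gcongr
    _ = _ := by ring

/-- The response integral splits into its components. -/
theorem response_integral_eq (h : LinearResponseSetting M V F σ κ ρ F' σ' G H δ₀ μ)
    (hu : IsTempered M V u) (ht : 0 ≤ t) (δ : ℝ) :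
    δ * ∫ s in (0 : ℝ)..t, ∑ i,
      (G i s * -steadyAverage M ρ (fun x => driftResponse ρ F' i x * semigroup κ (t - s) u x)
        + H i s ^ 2
          * steadyAverage M ρ (fun x => noiseResponse ρ σ' i x * semigroup κ (t - s) u x))
    = -(∑ i, ∫ s in (0 : ℝ)..t,
        steadyAverage M ρ (fun x => driftResponse ρ F' i x * semigroup κ (t - s) u x)
          * (δ * G i s))
      + ∑ i, ∫ s in (0 : ℝ)..t,
        steadyAverage M ρ (fun x => noiseResponse ρ σ' i x * semigroup κ (t - s) u x)
          * (δ * H i s ^ 2) := by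
  have h1 := fun i => h.intervalIntegrable_response (h.rapid_driftResponse i) hu ht
    ((h.integrable_drift i t ht).const_mul δ)
  have h2 := fun i => h.intervalIntegrable_response (h.rapid_noiseResponse i) hu ht
    ((h.integrable_diffusion i t ht).const_mul δ)
  rw [← intervalIntegral.integral_finsetSum fun i _ => h1 i,
    ← intervalIntegral.integral_finsetSum fun i _ => h2 i, neg_add_eq_sub,
    ← intervalIntegral.integral_sub (intervalIntegrable_fun_sum _ fun i _ => h2 i)
      (intervalIntegrable_fun_sum _ fun i _ => h1 i), ← intervalIntegral.integral_const_mul]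
  congr 1
  ext s
  rw [Finset.mul_sum, ← Finset.sum_sub_distrib]
  exact Finset.sum_congr rfl fun i _ => by ring

theorem steadyAverage_sum_response (h : LinearResponseSetting M V F σ κ ρ F' σ' G H δ₀ μ)
    {q : Fin d → State d → ℝ} (hq : ∀ i, IsRapidlyIntegrable M V fun x => q i x * ρ x)
    (hu : IsTempered M V u) (ht : 0 ≤ t) :
    steadyAverage M ρ (fun x => (∑ i, q i x) * semigroup κ t u x)
      = ∑ i, steadyAverage M ρ (fun x => q i x * semigroup κ t u x) := by
  simp only [steadyAverage, Finset.sum_mul]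
  exact integral_finsetSum _ fun i _ => h.integrableOn_response (hq i) hu ht

/-- For a homogeneous perturbation the component sum collapses to a single time integral. -/
theorem sum_response_integral_eq (h : LinearResponseSetting M V F σ κ ρ F' σ' G H δ₀ μ)
    {q : Fin d → State d → ℝ} (hq : ∀ i, IsRapidlyIntegrable M V fun x => q i x * ρ x)
    (hu : IsTempered M V u) (ht : 0 ≤ t) {a : Fin d → ℝ → ℝ} {b : ℝ → ℝ}
    (ha : ∀ i, IntervalIntegrable (a i) volume 0 t) (hab : ∀ i s, 0 ≤ s → a i s = b s) :
    ∑ i, ∫ s in (0 : ℝ)..t,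
        steadyAverage M ρ (fun x => q i x * semigroup κ (t - s) u x) * a i s
      = ∫ s in (0 : ℝ)..t,
        steadyAverage M ρ (fun x => (∑ i, q i x) * semigroup κ (t - s) u x) * b s := by
  rw [← intervalIntegral.integral_finsetSum fun i _ =>
    h.intervalIntegrable_response (hq i) hu ht (ha i)]
  refine intervalIntegral.integral_congr fun s hs => ?_
  rw [uIcc_of_le ht] at hs
  rw [h.steadyAverage_sum_response hq hu (sub_nonneg.2 hs.2), Finset.sum_mul]
  exact Finset.sum_congr rfl fun i _ => by rw [hab i s hs.1]

end LinearResponseSetting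

/-! ### Vector form and the final statement -/

theorem sum_driftResponse {d : ℕ} (ρ : State d → ℝ) (F' : Fin d → State d → ℝ) (x : State d) :
    ∑ i, driftResponse ρ F' i x = driftResponseVec ρ F' x := by
  simp only [driftResponse, driftResponseVec, divergence, Finset.mul_sum]

theorem sum_noiseResponse {d : ℕ} (ρ : State d → ℝ) (σ' : Fin d → State d → ℝ) (x : State d) :
    ∑ i, noiseResponse ρ σ' i x = noiseResponseVec ρ σ' x := by
  simp only [noiseResponse, noiseResponseVec, divergence, noiseOp, Finset.mul_sum,
    Finset.sum_add_distrib, mul_assoc]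
  rfl

theorem theorem1 {d : ℕ} (M : Set (State d)) (hM : IsOpen M)
    (V : State d → ℝ) (hV : IsWeight M V)
    -- the unperturbed system, its Markov semigroup and its steady state
    (F σ : Fin d → State d → ℝ)
    (hF : ∀ i, IsTempered M V (F i)) (hσ : ∀ i, IsTempered M V (σ i))
    (κ : ℝ → Kernel (State d) (State d))
    (hκ : IsTransitionFunction M (generator F σ) κ) (hκV : ActsOnTempered M V κ)
    (ρ : State d → ℝ) (hρ : IsSteadyState M κ ρ) (hρV : DecaysAtBoundary M V ρ)
    -- the perturbation
    (F' σ' : Fin d → State d → ℝ)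
    (hF' : ∀ i, IsTempered M V (F' i)) (hσ' : ∀ i, IsTempered M V (σ' i))
    (G H : Fin d → ℝ → ℝ)
    (hG : ∀ i, ∀ t, 0 ≤ t → IntervalIntegrable (G i) volume 0 t)
    (hH : ∀ i, ∀ t, 0 ≤ t → IntervalIntegrable (fun s => H i s ^ 2) volume 0 t)
    -- the laws of the perturbed system, started from the steady state
    (δ₀ : ℝ) (hδ₀ : 0 < δ₀) (μ : ℝ → ℝ → Measure (State d))
    (hμ : ∀ δ ∈ Ioc 0 δ₀, IsFokkerPlanckSolution M (perturbedGenerator F σ F' σ' G H δ)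
      (densityMeasure M ρ) (μ δ))
    (hμV : ∀ (k : ℕ) (T : ℝ), ∃ C : ℝ, ∀ δ ∈ Ioc 0 δ₀, ∀ t ∈ Icc 0 T,
      Integrable (fun x => V x ^ k) (μ δ t) ∧ ∫ x, V x ^ k ∂(μ δ t) ≤ C)
    -- the observable
    (u : State d → ℝ) (hu : IsTempered M V u) :
    -- all averages and time integrals exist
    (∀ t, 0 ≤ t → IntegrableOn (fun x => semigroup κ t u x * ρ x) M ∧
      ∀ δ ∈ Ioc 0 δ₀, Integrable u (μ δ t)) ∧
    (∀ i, ∀ t, 0 ≤ t →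
      IntegrableOn (fun x => driftResponse ρ F' i x * semigroup κ t u x * ρ x) M ∧
      IntegrableOn (fun x => noiseResponse ρ σ' i x * semigroup κ t u x * ρ x) M ∧
      IntervalIntegrable (fun s =>
        steadyAverage M ρ (fun x => driftResponse ρ F' i x * semigroup κ (t - s) u x) * G i s)
        volume 0 t ∧
      IntervalIntegrable (fun s =>
        steadyAverage M ρ (fun x => noiseResponse ρ σ' i x * semigroup κ (t - s) u x) * H i s ^ 2)
        volume 0 t) ∧
    -- the componentwise formula
    (∀ T : ℝ, ∃ C : ℝ, ∀ δ ∈ Ioc 0 δ₀, ∀ t ∈ Icc 0 T,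
      |(∫ x, u x ∂(μ δ t)) - steadyAverage M ρ (semigroup κ t u)
        - (-(∑ i, ∫ s in (0 : ℝ)..t,
              steadyAverage M ρ (fun x => driftResponse ρ F' i x * semigroup κ (t - s) u x)
                * (δ * G i s))
          + ∑ i, ∫ s in (0 : ℝ)..t,
              steadyAverage M ρ (fun x => noiseResponse ρ σ' i x * semigroup κ (t - s) u x)
                * (δ * H i s ^ 2))| ≤ C * δ ^ 2) ∧
    -- the vector form for homogeneous perturbations
    (∀ g h : ℝ → ℝ, (∀ i, ∀ s, 0 ≤ s → G i s = g s) → (∀ i, ∀ s, 0 ≤ s → H i s = h s) →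
      ∀ T : ℝ, ∃ C : ℝ, ∀ δ ∈ Ioc 0 δ₀, ∀ t ∈ Icc 0 T,
      |(∫ x, u x ∂(μ δ t)) - steadyAverage M ρ (semigroup κ t u)
        - (-(∫ s in (0 : ℝ)..t,
              steadyAverage M ρ (fun x => driftResponseVec ρ F' x * semigroup κ (t - s) u x)
                * (δ * g s))
          + ∫ s in (0 : ℝ)..t,
              steadyAverage M ρ (fun x => noiseResponseVec ρ σ' x * semigroup κ (t - s) u x)
                * (δ * h s ^ 2))| ≤ C * δ ^ 2) := by
  have h : LinearResponseSetting M V F σ κ ρ F' σ' G H δ₀ μ :=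
    ⟨hM, hV, hF, hσ, hκ, hκV, hρ, hρV, hF', hσ', hG, hH, hμ, hμV⟩
  have componentwise := fun T => h.exists_linear_response hu T
  refine ⟨fun t ht => ⟨?_, fun δ hδ => h.integrable hδ ht hu⟩, fun i t ht => ⟨?_, ?_, ?_, ?_⟩,
    fun T => ?_, fun g k hg hk T => ?_⟩
  · exact (integrable_densityMeasure_iff hM hρ.smooth.continuousOn hρ.pos).1
      (h.integrable_steady (hκV.isTempered_semigroup hu ht))
  · exact h.integrableOn_response (h.rapid_driftResponse i) hu ht
  · exact h.integrableOn_response (h.rapid_noiseResponse i) hu ht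
  · exact h.intervalIntegrable_response (h.rapid_driftResponse i) hu ht (hG i t ht)
  · exact h.intervalIntegrable_response (h.rapid_noiseResponse i) hu ht (hH i t ht)
  · obtain ⟨C, hC⟩ := componentwise T
    refine ⟨C, fun δ hδ t ht => ?_⟩
    rw [← h.response_integral_eq hu ht.1]
    exact hC δ hδ t ht
  · obtain ⟨C, hC⟩ := componentwise T
    refine ⟨C, fun δ hδ t ht => ?_⟩
    -- The vector response functions are the sums of the componentwise ones, so with common time
    -- factors the vector formula is the componentwise one with sum and integrals interchanged.
    simp only [← sum_driftResponse, ← sum_noiseResponse]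
    rw [← h.sum_response_integral_eq h.rapid_driftResponse hu ht.1
        (fun i => (hG i t ht.1).const_mul δ) (fun i s hs => by rw [hg i s hs]),
      ← h.sum_response_integral_eq h.rapid_noiseResponse hu ht.1
        (fun i => (hH i t ht.1).const_mul δ) (fun i s hs => by rw [hk i s hs]),
      ← h.response_integral_eq hu ht.1]
    exact hC δ hδ t ht
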